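/- Let $\mathfrak g$ be a (possibly infinite-dimensional) complex Lie algebra with a symmetric invariant bilinear form $\langle\cdot,\cdot\rangle$, and let $\psi:\mathfrak g\times\mathfrak g\to\mathbb C$ be a 2-cocycle, i.e. a skew-symmetric bilinear form with $\psi(x,[y,z])+\psi(y,[z,x])+\psi(z,[x,y])=0$. Let $\widehat{\mathfrak g}=\mathfrak g\otimes\mathbb C[t,t^{-1}]\oplus\mathbb C K_2$ and $\widetilde{\mathfrak g}=\mathfrak g\otimes\mathbb C[t,t^{-1}]\oplus\mathbb C K_1\oplus\mathbb C K_2$ be the Lie algebras with $K_1,K_2$ central and with brackets $$[a\otimes t^i,b\otimes t^j]=[a,b]\otimes t^{i+j}+i\langle a,b\rangle\delta_{i+j,0}K_2,$$ $$[a\otimes t^i,b\otimes t^j]=[a,b]\otimes t^{i+j}+\psi(a,b)\delta_{i+j+1,0}K_1+i\langle a,b\rangle\delta_{i+j,0}K_2,$$ respectively. For $\ell_1,\ell_2\in\mathbb C$ let $$V_{\widehat{\mathfrak g}}(\ell_2,0)=U(\widehat{\mathfrak g})\otimes_{U(\mathfrak g\otimes\mathbb C[t]+\mathbb C K_2)}\mathbb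 C,\qquad V_{\widetilde{\mathfrak g}}(\ell_{12},0)=U(\widetilde{\mathfrak g})\otimes_{U(\mathfrak g\otimes\mathbb C[t]+\mathbb C K_1+\mathbb C K_2)}\mathbb C,$$ where $\mathfrak g\otimes\mathbb C[t]$ acts on $\mathbb C$ by zero and $K_i$ acts by $\ell_i$. Write $a(n)$ for the action of $a\otimes t^n$ and $\mathbf 1=1\otimes 1$. By a vertex algebra we mean a complex vector space $V$ with a vacuum vector and a linear map $Y:V\to\mathrm{Hom}(V,V((x)))$, $Y(u,x)=\sum_n u_nx^{-n-1}$, satisfying the vacuum and creation properties and the Jacobi identity; an ideal is a subspace $J$ with $u_nv,\,v_nu\in J$ for all $u\in V$, $v\in J$, $n\in\mathbb Z$; a maximal ideal is an ideal that is maximal among the proper ideals; isomorphisms preserve the vacuum and all products $u_nv$. Suppose that $\psi$ is trivial, i.e. there is a linear map $\mu:\mathfrak g\to\mathbb C$ with $\psi(x,y)=\mu([x,y])$ for all $x,y\in\mathfrak g$, and that $\ell_1\neq0$; let $\ell_2\in\mathbb C$ be arbitrary. Then each of $V_{\widetilde{\mathfrak g}}(\ell_{12},0)$ and $V_{\widehat{\mathfrak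 g}}(\ell_2,0)$ carries exactly one vertex algebra structure with vacuum $\mathbf 1$ and $Y(a(-1)\mathbf 1,x)=\sum_{n\in\mathbb Z}a(n)x^{-n-1}$ for all $a\in\mathfrak g$, and for these structures: 1. There is an isomorphism of vertex algebras $\varphi:V_{\widetilde{\mathfrak g}}(\ell_{12},0)\to V_{\widehat{\mathfrak g}}(\ell_2,0)$ such that $J\mapsto\varphi(J)$ is an inclusion-preserving bijection (with inclusion-preserving inverse) from the ideals of $V_{\widetilde{\mathfrak g}}(\ell_{12},0)$ onto the ideals of $V_{\widehat{\mathfrak g}}(\ell_2,0)$, $J$ is a maximal ideal if and only if $\varphi(J)$ is, and $V_{\widetilde{\mathfrak g}}(\ell_{12},0)/J\cong V_{\widehat{\mathfrak g}}(\ell_2,0)/\varphi(J)$ as vertex algebras for every ideal $J$. So the simple quotients of the two vertex algebras correspond to each other under $\varphi$ and are isomorphic. 2. In particular, one of the two vertex algebras has exactly one maximal ideal if and only if the other has, and in that case the quotients by these maximal ideals satisfy $L_{\widetilde{\mathfrak g}}(\ell_{12},0)\cong L_{\widehat{\mathfrak g}}(\ell_2,0)$ as vertex algebras. -/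

import Mathlib

open scoped TensorProduct

noncomputable section

/-! ## Vertex algebras over `ℂ` -/

/-- A vertex algebra structure on a complex vector space `V`: a linear map
`Y : V → Hom(V, V((x)))`, `Y(u,x) = ∑ₙ uₙ x^{-n-1}`, and a vacuum vector, subject to the vacuum
property, the creation property and the Jacobi identity, the latter in the component form of
Borcherds. All sums are finite since `Y(u,x)v` is a Laurent series. -/
@[ext]
structure VertexAlgebra (V : Type*) [AddCommGroup V] [Module ℂ V] where
  /-- the state-field correspondence -/
  Y : V →ₗ[ℂ] VertexOperator ℂ V
  /-- the vacuum vector -/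
  vac : V
  vac_nth : ∀ (n : ℤ) (v : V), VertexOperator.ncoeff (Y vac) n v = if n = -1 then v else 0
  nth_vac : ∀ v : V, VertexOperator.ncoeff (Y v) (-1) vac = v
  nth_vac_of_nonneg : ∀ (v : V) (n : ℤ), 0 ≤ n → VertexOperator.ncoeff (Y v) n vac = 0
  jacobi : ∀ (u v w : V) (l m n : ℤ),
    (∑ᶠ i : ℕ, ((-1 : ℤ) ^ i * Ring.choose l i) •
        VertexOperator.ncoeff (Y u) (m + l - i) (VertexOperator.ncoeff (Y v) (n + i) w)) -
      (∑ᶠ i : ℕ, ((-1 : ℤ) ^ i * Ring.choose l i * (Int.negOnePow l : ℤ)) •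
        VertexOperator.ncoeff (Y v) (n + l - i) (VertexOperator.ncoeff (Y u) (m + i) w)) =
    ∑ᶠ i : ℕ, Ring.choose m i •
        VertexOperator.ncoeff (Y (VertexOperator.ncoeff (Y u) (l + i) v)) (m + n - i) w

namespace VertexAlgebra

variable {V W : Type*} [AddCommGroup V] [Module ℂ V] [AddCommGroup W] [Module ℂ W]

/-- The `n`-th product `uₙ v`. -/
abbrev nth (S : VertexAlgebra V) (u : V) (n : ℤ) (v : V) : V := VertexOperator.ncoeff (S.Y u) n v

/-- Isomorphisms of vertex algebras. -/
structure Iso (S : VertexAlgebra V) (T : VertexAlgebra W) extends V ≃ₗ[ℂ] W where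
  map_vac' : toFun S.vac = T.vac
  map_nth' : ∀ (u v : V) (n : ℤ), toFun (S.nth u n v) = T.nth (toFun u) n (toFun v)

/-- (Two-sided) ideals of a vertex algebra. -/
@[ext]
structure VIdeal (S : VertexAlgebra V) where
  /-- the underlying subspace -/
  carrier : Submodule ℂ V
  nth_mem : ∀ (v w : V) (n : ℤ), w ∈ carrier → S.nth v n w ∈ carrier
  nth_mem' : ∀ (v w : V) (n : ℤ), w ∈ carrier → S.nth w n v ∈ carrier

namespace VIdeal

variable {S : VertexAlgebra V}

/-- Ideals are ordered by inclusion. -/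
instance : PartialOrder S.VIdeal := PartialOrder.lift VIdeal.carrier fun _ _ h => VIdeal.ext h

/-- Maximal ideals: maximal among the proper ideals. -/
def IsMaximal (J : S.VIdeal) : Prop :=
  J.carrier ≠ ⊤ ∧ ∀ I : S.VIdeal, J < I → I.carrier = ⊤

/-- `J` is the one and only maximal ideal. -/
def IsTheMaximal (J : S.VIdeal) : Prop := ∀ I : S.VIdeal, I.IsMaximal ↔ I = J

/-- The operator on `V ⧸ J` induced by `Y(u,x)`. -/
def quotField (J : S.VIdeal) (u : V) : VertexOperator ℂ (V ⧸ J.carrier) :=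
  HVertexOperator.of_coeff
    (fun n => J.carrier.mapQ J.carrier (VertexOperator.ncoeff (S.Y u) (-n - 1))
      fun w hw => J.nth_mem u w _ hw) (by
    intro x
    obtain ⟨v, rfl⟩ := Submodule.Quotient.mk_surjective _ x
    refine Set.IsPWO.mono (HVertexOperator.coeff_isPWOsupport (S.Y u) v) ?_
    intro n hn hn'
    apply hn
    simp only [Submodule.mapQ_apply, VertexOperator.ncoeff_apply, HVertexOperator.coeff_apply_apply]
    rw [Submodule.Quotient.mk_eq_zero]
    have : -(-n - 1) - 1 = n := by ring
    rw [this, hn']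
    exact J.carrier.zero_mem)

theorem ncoeff_quotField (J : S.VIdeal) (u v : V) (n : ℤ) :
    VertexOperator.ncoeff (J.quotField u) n (Submodule.Quotient.mk v) =
      Submodule.Quotient.mk (VertexOperator.ncoeff (S.Y u) n v) := by
  have h : -(-n - 1) - 1 = n := by ring
  rw [VertexOperator.ncoeff_apply, quotField, HVertexOperator.coeff_of_coeff]
  change Submodule.Quotient.mk (VertexOperator.ncoeff (S.Y u) (-(-n - 1) - 1) v) = _
  rw [h]

theorem field_ext {A B : VertexOperator ℂ V}
    (h : ∀ (n : ℤ) (v : V), VertexOperator.ncoeff A n v = VertexOperator.ncoeff B n v) :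
    A = B := by
  apply HVertexOperator.coeff_inj
  funext n
  ext v
  have hn := h (-n - 1) v
  have h' : -(-n - 1) - 1 = n := by ring
  rwa [VertexOperator.ncoeff_apply, VertexOperator.ncoeff_apply, h'] at hn

/-- The state-field correspondence on `V ⧸ J`. -/
def quotY (J : S.VIdeal) : (V ⧸ J.carrier) →ₗ[ℂ] VertexOperator ℂ (V ⧸ J.carrier) :=
  J.carrier.liftQ
    { toFun := J.quotField
      map_add' := fun a b => field_ext fun n x => by
        obtain ⟨v, rfl⟩ := Submodule.Quotient.mk_surjective _ x
        simp [ncoeff_quotField]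
      map_smul' := fun r a => field_ext fun n x => by
        obtain ⟨v, rfl⟩ := Submodule.Quotient.mk_surjective _ x
        simp [ncoeff_quotField] }
    (fun u hu => by
      rw [LinearMap.mem_ker]
      refine field_ext fun n x => ?_
      obtain ⟨v, rfl⟩ := Submodule.Quotient.mk_surjective _ x
      have h0 := J.nth_mem' v u n hu
      simpa [ncoeff_quotField] using h0)

theorem ncoeff_quotY (J : S.VIdeal) (u v : V) (n : ℤ) :
    VertexOperator.ncoeff (J.quotY (Submodule.Quotient.mk u)) n (Submodule.Quotient.mk v) =
      Submodule.Quotient.mk (VertexOperator.ncoeff (S.Y u) n v) :=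
  J.ncoeff_quotField u v n

end VIdeal

theorem exists_ncoeff_eq_zero (A : VertexOperator ℂ V) (v : V) :
    ∃ N : ℤ, ∀ n, N ≤ n → VertexOperator.ncoeff A n v = 0 := by
  refine ⟨-HahnSeries.order ((HahnModule.of ℂ).symm (A v)), fun n hn => ?_⟩
  apply VertexOperator.ncoeff_eq_zero_of_lt_order
  lia

theorem finite_support_of_eventually {E : Type*} [AddCommGroup E] {f : ℕ → E} (N : ℤ) (h : ∀ i : ℕ, N ≤ i → f i = 0) :
    (Function.support f).Finite := by
  refine (Set.finite_lt_nat N.toNat).subset fun i hi => ?_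
  by_contra hlt
  exact hi (h i (by simp only [Set.mem_ofPred_eq] at hlt; lia))

theorem mk_finsum (J : Submodule ℂ V) {f : ℕ → V} (hf : (Function.support f).Finite) :
    (Submodule.Quotient.mk (∑ᶠ i, f i) : V ⧸ J) = ∑ᶠ i, Submodule.Quotient.mk (f i) :=
  AddMonoidHom.map_finsum (J.mkQ.toAddMonoidHom) hf

/-- The quotient vertex algebra `V ⧸ J`. -/
def quot (S : VertexAlgebra V) (J : S.VIdeal) : VertexAlgebra (V ⧸ J.carrier) where
  Y := J.quotY
  vac := Submodule.Quotient.mk S.vac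
  vac_nth n x := by
    obtain ⟨v, rfl⟩ := Submodule.Quotient.mk_surjective _ x
    rw [VIdeal.ncoeff_quotY, S.vac_nth]
    split_ifs <;> simp
  nth_vac x := by
    obtain ⟨v, rfl⟩ := Submodule.Quotient.mk_surjective _ x
    rw [VIdeal.ncoeff_quotY, S.nth_vac]
  nth_vac_of_nonneg x n hn := by
    obtain ⟨v, rfl⟩ := Submodule.Quotient.mk_surjective _ x
    rw [VIdeal.ncoeff_quotY, S.nth_vac_of_nonneg v n hn, Submodule.Quotient.mk_zero]
  jacobi x y z l m n := by
    obtain ⟨u, rfl⟩ := Submodule.Quotient.mk_surjective _ x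
    obtain ⟨v, rfl⟩ := Submodule.Quotient.mk_surjective _ y
    obtain ⟨w, rfl⟩ := Submodule.Quotient.mk_surjective _ z
    have h := congrArg (Submodule.Quotient.mk (p := J.carrier)) (S.jacobi u v w l m n)
    obtain ⟨N₁, h₁⟩ := exists_ncoeff_eq_zero (S.Y v) w
    obtain ⟨N₂, h₂⟩ := exists_ncoeff_eq_zero (S.Y u) w
    obtain ⟨N₃, h₃⟩ := exists_ncoeff_eq_zero (S.Y u) v
    rw [Submodule.Quotient.mk_sub, mk_finsum, mk_finsum, mk_finsum] at h
    · simpa only [VIdeal.ncoeff_quotY, Submodule.Quotient.mk_smul] using h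
    · exact finite_support_of_eventually (N₃ - l) fun i hi => by
        rw [h₃ _ (by lia)]; simp
    · exact finite_support_of_eventually (N₂ - m) fun i hi => by
        rw [h₂ _ (by lia)]; simp
    · exact finite_support_of_eventually (N₁ - n) fun i hi => by
        rw [h₁ _ (by lia)]; simp

end VertexAlgebra

/-! ## Induced modules -/

section Induced

attribute [local instance 100] LieRing.ofAssociativeRing

variable {L : Type*} [LieRing L] [LieAlgebra ℂ L]

/-- The algebra map `U(P) → U(L)` of a Lie subalgebra `P ⊆ L`. -/
def envelopingIncl (P : LieSubalgebra ℂ L) :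
    UniversalEnvelopingAlgebra ℂ P →ₐ[ℂ] UniversalEnvelopingAlgebra ℂ L :=
  UniversalEnvelopingAlgebra.lift ℂ ((UniversalEnvelopingAlgebra.ι ℂ).comp P.incl)

/-- The relations `u p ⊗ z = u ⊗ p z`, with `u ∈ U(L)`, `p ∈ U(P)`, `z ∈ ℂ`, that turn
`U(L) ⊗_ℂ ℂ` into `U(L) ⊗_{U(P)} ℂ`. Here `U(P)` acts on `ℂ` through the character `χ` of `P`. -/
def inducedRel (P : LieSubalgebra ℂ L) (χ : P →ₗ⁅ℂ⁆ ℂ) :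
    Submodule (UniversalEnvelopingAlgebra ℂ L) (UniversalEnvelopingAlgebra ℂ L ⊗[ℂ] ℂ) :=
  Submodule.span _ {r | ∃ (u : UniversalEnvelopingAlgebra ℂ L)
    (p : UniversalEnvelopingAlgebra ℂ P) (z : ℂ),
    r = (u * envelopingIncl P p) ⊗ₜ[ℂ] z -
      u ⊗ₜ[ℂ] (UniversalEnvelopingAlgebra.lift ℂ χ p * z)}

/-- The induced module `U(L) ⊗_{U(P)} ℂ`, where `P` acts on `ℂ` by the character `χ`. -/
def InducedModule (P : LieSubalgebra ℂ L) (χ : P →ₗ⁅ℂ⁆ ℂ) : Type _ :=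
  (UniversalEnvelopingAlgebra ℂ L ⊗[ℂ] ℂ) ⧸ inducedRel P χ

namespace InducedModule

variable (P : LieSubalgebra ℂ L) (χ : P →ₗ⁅ℂ⁆ ℂ)

instance : AddCommGroup (InducedModule P χ) :=
  inferInstanceAs (AddCommGroup ((UniversalEnvelopingAlgebra ℂ L ⊗[ℂ] ℂ) ⧸ inducedRel P χ))

instance : Module (UniversalEnvelopingAlgebra ℂ L) (InducedModule P χ) :=
  inferInstanceAs (Module (UniversalEnvelopingAlgebra ℂ L)
    ((UniversalEnvelopingAlgebra ℂ L ⊗[ℂ] ℂ) ⧸ inducedRel P χ))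

instance : Module ℂ (InducedModule P χ) :=
  inferInstanceAs (Module ℂ ((UniversalEnvelopingAlgebra ℂ L ⊗[ℂ] ℂ) ⧸ inducedRel P χ))

instance : IsScalarTower ℂ (UniversalEnvelopingAlgebra ℂ L) (InducedModule P χ) :=
  inferInstanceAs (IsScalarTower ℂ (UniversalEnvelopingAlgebra ℂ L)
    ((UniversalEnvelopingAlgebra ℂ L ⊗[ℂ] ℂ) ⧸ inducedRel P χ))

/-- The vector `1 ⊗ 1`. -/
def one : InducedModule P χ := Submodule.Quotient.mk (1 ⊗ₜ[ℂ] 1)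

variable {P χ}

/-- The action of `x ∈ L` on the induced module. -/
def act (x : L) (v : InducedModule P χ) : InducedModule P χ :=
  UniversalEnvelopingAlgebra.ι ℂ x • v

end InducedModule

end Induced

/-! ## Affine Lie algebras -/

section Affine

open LieModule.Cohomology LieAlgebra

variable {𝔤 : Type*} [LieRing 𝔤] [LieAlgebra ℂ 𝔤]

/-- A 2-cocycle on `𝔤` with values in `ℂ`: a skew-symmetric bilinear form with
`ψ(x,[y,z]) + ψ(y,[z,x]) + ψ(z,[x,y]) = 0`. -/
structure IsTwoCocycle (ψ : LinearMap.BilinForm ℂ 𝔤) : Prop where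
  skew : ∀ x y, ψ x y = -ψ y x
  cyclic : ∀ x y z, ψ x ⁅y, z⁆ + ψ y ⁅z, x⁆ + ψ z ⁅x, y⁆ = 0

/-- A 2-cocycle is trivial if it is `(x,y) ↦ μ([x,y])` for a linear functional `μ`. -/
def IsTrivialCocycle (ψ : LinearMap.BilinForm ℂ 𝔤) : Prop :=
  ∃ μ : 𝔤 →ₗ[ℂ] ℂ, ∀ x y, ψ x y = μ ⁅x, y⁆

/-- The loop algebra `𝔤 ⊗ ℂ[t,t⁻¹]`. -/
def LoopAlg (𝔤 : Type*) [LieRing 𝔤] [LieAlgebra ℂ 𝔤] : Type _ := loopAlgebra ℂ ℤ 𝔤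

instance : LieRing (LoopAlg 𝔤) := inferInstanceAs (LieRing (loopAlgebra ℂ ℤ 𝔤))

instance : LieAlgebra ℂ (LoopAlg 𝔤) := inferInstanceAs (LieAlgebra ℂ (loopAlgebra ℂ ℤ 𝔤))

/-- The identity map to `ℂ[t,t⁻¹] ⊗ 𝔤`. -/
def loopToTensor : LoopAlg 𝔤 →ₗ[ℂ] AddMonoidAlgebra ℂ ℤ ⊗[ℂ] 𝔤 where
  toFun x := x
  map_add' _ _ := rfl
  map_smul' _ _ := rfl

/-- The element `a ⊗ tⁿ` of the loop algebra of `𝔤`. -/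
def loopMon (a : 𝔤) (n : ℤ) : LoopAlg 𝔤 :=
  (AddMonoidAlgebra.single n 1 ⊗ₜ[ℂ] a : AddMonoidAlgebra ℂ ℤ ⊗[ℂ] 𝔤)

theorem loopMon_add (a b : 𝔤) (n : ℤ) : loopMon (a + b) n = loopMon a n + loopMon b n :=
  TensorProduct.tmul_add _ _ _

theorem loopMon_smul (r : ℂ) (a : 𝔤) (n : ℤ) : loopMon (r • a) n = r • loopMon a n :=
  TensorProduct.tmul_smul r _ _

theorem lie_loopMon (a b : 𝔤) (i j : ℤ) :
    ⁅loopMon a i, loopMon b j⁆ = loopMon ⁅a, b⁆ (i + j) := by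
  change ((AddMonoidAlgebra.single i (1 : ℂ) * AddMonoidAlgebra.single j (1 : ℂ)) ⊗ₜ[ℂ] ⁅a, b⁆ :
    AddMonoidAlgebra ℂ ℤ ⊗[ℂ] 𝔤) = _
  rw [AddMonoidAlgebra.single_mul_single, mul_one, loopMon]

theorem loop_induction {p : LoopAlg 𝔤 → Prop}
    (hadd : ∀ x y, p x → p y → p (x + y)) (hmon : ∀ a n, p (loopMon a n)) (x) : p x := by
  have h0 : p 0 := by
    have h := hmon 0 0
    rwa [← zero_smul ℂ (0 : 𝔤), loopMon_smul, zero_smul] at h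
  change AddMonoidAlgebra ℂ ℤ ⊗[ℂ] 𝔤 at x
  induction x using TensorProduct.induction_on with
  | zero => exact h0
  | add x y hx hy => exact hadd x y hx hy
  | tmul f a =>
    induction f using AddMonoidAlgebra.induction_linear with
    | zero => rw [TensorProduct.zero_tmul]; exact h0
    | add f g hf hg => rw [TensorProduct.add_tmul]; exact hadd _ _ hf hg
    | single n r =>
      have h : AddMonoidAlgebra.single n r = r • (AddMonoidAlgebra.single n 1 :
          AddMonoidAlgebra ℂ ℤ) := by
        rw [AddMonoidAlgebra.smul_single, smul_eq_mul, mul_one]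
      rw [h, TensorProduct.smul_tmul]
      exact hmon (r • a) n

/-- The bilinear form on `ℂ[t,t⁻¹]` with `(tⁱ, tʲ) ↦ w i j`. -/
def laurentForm (w : ℤ → ℤ → ℂ) : LinearMap.BilinForm ℂ (AddMonoidAlgebra ℂ ℤ) :=
  (AddMonoidAlgebra.basis ℤ ℂ).constr ℂ fun i => (AddMonoidAlgebra.basis ℤ ℂ).constr ℂ (w i)

/-- The bilinear form on the loop algebra with `(a ⊗ tⁱ, b ⊗ tʲ) ↦ w i j * β(a,b)`. -/
def loopForm (w : ℤ → ℤ → ℂ) (β : LinearMap.BilinForm ℂ 𝔤) :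
    LinearMap.BilinForm ℂ (LoopAlg 𝔤) :=
  (LinearMap.BilinForm.tmul (laurentForm w) β).compl₁₂ loopToTensor loopToTensor

theorem loopForm_loopMon (w : ℤ → ℤ → ℂ) (β : LinearMap.BilinForm ℂ 𝔤) (a b : 𝔤) (i j : ℤ) :
    loopForm w β (loopMon a i) (loopMon b j) = w i j * β a b := by
  have h : laurentForm w (AddMonoidAlgebra.single i 1) (AddMonoidAlgebra.single j 1) = w i j := by
    rw [laurentForm, ← AddMonoidAlgebra.basis_apply, ← AddMonoidAlgebra.basis_apply,
      Module.Basis.constr_basis, Module.Basis.constr_basis]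
  change β a b • laurentForm w (AddMonoidAlgebra.single i 1) (AddMonoidAlgebra.single j 1) = _
  rw [h, smul_eq_mul, mul_comm]

/-- `(a ⊗ tⁱ, b ⊗ tʲ) ↦ i ⟨a,b⟩ δ_{i+j,0}`. -/
def levelForm (B : LinearMap.BilinForm ℂ 𝔤) : LinearMap.BilinForm ℂ (LoopAlg 𝔤) :=
  loopForm (fun i j => if i + j = 0 then (i : ℂ) else 0) B

/-- `(a ⊗ tⁱ, b ⊗ tʲ) ↦ ψ(a,b) δ_{i+j+1,0}`. -/
def shiftForm (ψ : LinearMap.BilinForm ℂ 𝔤) : LinearMap.BilinForm ℂ (LoopAlg 𝔤) :=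
  loopForm (fun i j => if i + j + 1 = 0 then 1 else 0) ψ

theorem levelForm_loopMon (B : LinearMap.BilinForm ℂ 𝔤) (a b : 𝔤) (i j : ℤ) :
    levelForm B (loopMon a i) (loopMon b j) = if i + j = 0 then i * B a b else 0 := by
  rw [levelForm, loopForm_loopMon]; split_ifs <;> simp

theorem shiftForm_loopMon (ψ : LinearMap.BilinForm ℂ 𝔤) (a b : 𝔤) (i j : ℤ) :
    shiftForm ψ (loopMon a i) (loopMon b j) = if i + j + 1 = 0 then ψ a b else 0 := by
  rw [shiftForm, loopForm_loopMon]; split_ifs <;> simp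

theorem self_eq_zero_of_skew (F : LinearMap.BilinForm ℂ (LoopAlg 𝔤))
    (h : ∀ a b i j, F (loopMon a i) (loopMon b j) = -F (loopMon b j) (loopMon a i)) (x) :
    F x x = 0 := by
  have key : ∀ x y, F x y = -F y x := fun x y => by
    induction x using loop_induction with
    | hadd x x' hx hx' => rw [map_add, LinearMap.add_apply, hx, hx', map_add]; ring
    | hmon a i =>
      induction y using loop_induction with
      | hadd y y' hy hy' => rw [map_add, hy, hy', map_add, LinearMap.add_apply]; ring
      | hmon b j => exact h a b i j
  exact self_eq_neg.mp (key x x)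

theorem cocycle_of_loopMon (F : LinearMap.BilinForm ℂ (LoopAlg 𝔤))
    (h : ∀ a b c i j k, F (loopMon a i) (loopMon ⁅b, c⁆ (j + k)) =
      F (loopMon ⁅a, b⁆ (i + j)) (loopMon c k) + F (loopMon b j) (loopMon ⁅a, c⁆ (i + k)))
    (x y z) : F x ⁅y, z⁆ = F ⁅x, y⁆ z + F y ⁅x, z⁆ := by
  induction x using loop_induction with
  | hadd x x' hx hx' => simp only [map_add, LinearMap.add_apply, add_lie, hx, hx']; ring
  | hmon a i =>
    induction y using loop_induction with
    | hadd y y' hy hy' =>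
      simp only [map_add, LinearMap.add_apply, add_lie, lie_add, hy, hy']; ring
    | hmon b j =>
      induction z using loop_induction with
      | hadd z z' hz hz' => simp only [map_add, lie_add, hz, hz']; ring
      | hmon c k => simp only [lie_loopMon]; exact h a b c i j k

theorem levelForm_self {B : LinearMap.BilinForm ℂ 𝔤} (hB : B.IsSymm) (x) :
    levelForm B x x = 0 :=
  self_eq_zero_of_skew _ (fun a b i j => by
    simp only [levelForm_loopMon, add_comm j i]
    split_ifs with h
    · rw [hB.eq b a, show j = -i by lia]; push_cast; ring
    · simp) x

theorem levelForm_cocycle {B : LinearMap.BilinForm ℂ 𝔤}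
    (hinv : B.lieInvariant 𝔤) (x y z) :
    levelForm B x ⁅y, z⁆ = levelForm B ⁅x, y⁆ z + levelForm B y ⁅x, z⁆ :=
  cocycle_of_loopMon _ (fun a b c i j k => by
    have h1 : B b ⁅a, c⁆ = -B a ⁅b, c⁆ := by
      have e1 := hinv a b c
      have e2 := hinv b a c
      rw [← lie_skew, map_neg, LinearMap.neg_apply] at e2
      rw [e1, neg_neg] at e2
      exact e2
    have h2 : B ⁅a, b⁆ c = B a ⁅b, c⁆ := by rw [hinv, h1, neg_neg]
    simp only [levelForm_loopMon, h1, h2, show i + j + k = i + (j + k) by ring,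
      show j + (i + k) = i + (j + k) by ring]
    split_ifs
    · push_cast; ring
    · simp) x y z

theorem shiftForm_self {ψ : LinearMap.BilinForm ℂ 𝔤} (hψ : IsTwoCocycle ψ) (x) :
    shiftForm ψ x x = 0 :=
  self_eq_zero_of_skew _ (fun a b i j => by
    simp only [shiftForm_loopMon, add_comm j i]
    split_ifs
    · exact hψ.skew a b
    · simp) x

theorem shiftForm_cocycle {ψ : LinearMap.BilinForm ℂ 𝔤} (hψ : IsTwoCocycle ψ) (x y z) :
    shiftForm ψ x ⁅y, z⁆ = shiftForm ψ ⁅x, y⁆ z + shiftForm ψ y ⁅x, z⁆ :=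
  cocycle_of_loopMon _ (fun a b c i j k => by
    have h := hψ.cyclic a b c
    rw [hψ.skew c, ← lie_skew c a, map_neg] at h
    simp only [shiftForm_loopMon, show i + j + k = i + (j + k) by ring,
      show j + (i + k) = i + (j + k) by ring]
    split_ifs
    · linear_combination h
    · simp) x y z

/-- The cocycle of the affine Lie algebra `𝔤̂`. -/
def hatCocycle (B : LinearMap.BilinForm ℂ 𝔤) (hB : B.IsSymm) (hinv : B.lieInvariant 𝔤) :
    twoCocycle ℂ (LoopAlg 𝔤) (TrivialLieModule ℂ (LoopAlg 𝔤) ℂ) where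
  val := ⟨(levelForm B).compr₂ (TrivialLieModule.equiv ℂ (LoopAlg 𝔤) ℂ).symm,
    fun x => levelForm_self hB x⟩
  property := (mem_twoCocycle_iff_of_trivial ..).2 fun x y z => levelForm_cocycle hinv x y z

/-- The cocycle of the generalized affine Lie algebra `𝔤̃`, with values in `ℂ K₁ ⊕ ℂ K₂`. -/
def tildeCocycle (B ψ : LinearMap.BilinForm ℂ 𝔤) (hB : B.IsSymm) (hinv : B.lieInvariant 𝔤)
    (hψ : IsTwoCocycle ψ) :
    twoCocycle ℂ (LoopAlg 𝔤) (TrivialLieModule ℂ (LoopAlg 𝔤) (ℂ × ℂ)) where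
  val := ⟨((shiftForm ψ).compr₂ (LinearMap.inl ℂ ℂ ℂ) +
      (levelForm B).compr₂ (LinearMap.inr ℂ ℂ ℂ)).compr₂
        (TrivialLieModule.equiv ℂ (LoopAlg 𝔤) (ℂ × ℂ)).symm, fun x => by
    simp [levelForm_self hB, shiftForm_self hψ]⟩
  property := (mem_twoCocycle_iff_of_trivial ..).2 fun x y z => by
    change (TrivialLieModule.equiv ℂ (LoopAlg 𝔤) (ℂ × ℂ)).symm _ =
      (TrivialLieModule.equiv ℂ (LoopAlg 𝔤) (ℂ × ℂ)).symm _ +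
      (TrivialLieModule.equiv ℂ (LoopAlg 𝔤) (ℂ × ℂ)).symm _
    rw [← map_add]
    congr 1
    ext
    · simp [shiftForm_cocycle hψ x y z]
    · simp [levelForm_cocycle hinv x y z]

/-! The two affine Lie algebras are central extensions of the loop algebra; the following notions
are common to both. -/

section Extension

variable {M : Type*} [AddCommGroup M] [Module ℂ M]
  (c : twoCocycle ℂ (LoopAlg 𝔤) (TrivialLieModule ℂ (LoopAlg 𝔤) M))

/-- The element `a(n) = a ⊗ tⁿ` of the extension. -/
def genEl (a : 𝔤) (n : ℤ) : LieAlgebra.ofTwoCocycle c := ofProd c (loopMon a n, 0)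

/-- The central element given by `m`. -/
def centralEl (m : M) : LieAlgebra.ofTwoCocycle c :=
  ofProd c (0, (TrivialLieModule.equiv ℂ (LoopAlg 𝔤) M).symm m)

theorem lie_centralEl (x : LieAlgebra.ofTwoCocycle c) (m : M) : ⁅x, centralEl c m⁆ = 0 := by
  simp only [centralEl, bracket_ofTwoCocycle, Equiv.symm_apply_apply, trivial_lie_zero,
    lie_zero, add_zero, sub_zero, map_zero]
  exact of_zero c

/-- The subspace `𝔤 ⊗ ℂ[t]` of the loop algebra. -/
def polyPart (𝔤 : Type*) [LieRing 𝔤] [LieAlgebra ℂ 𝔤] : Submodule ℂ (LoopAlg 𝔤) :=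
  Submodule.span ℂ {x | ∃ (a : 𝔤) (n : ℤ), 0 ≤ n ∧ x = loopMon a n}

theorem lie_mem_polyPart {x y : LoopAlg 𝔤} (hx : x ∈ polyPart 𝔤) (hy : y ∈ polyPart 𝔤) :
    ⁅x, y⁆ ∈ polyPart 𝔤 := by
  induction hx using Submodule.span_induction with
  | zero => simp
  | add x x' _ _ h h' => rw [add_lie]; exact add_mem h h'
  | smul r x _ h => rw [smul_lie]; exact Submodule.smul_mem _ r h
  | mem x hx =>
    obtain ⟨a, i, hi, rfl⟩ := hx
    induction hy using Submodule.span_induction with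
    | zero => simp
    | add y y' _ _ h h' => rw [lie_add]; exact add_mem h h'
    | smul r y _ h => rw [lie_smul]; exact Submodule.smul_mem _ r h
    | mem y hy =>
      obtain ⟨b, j, hj, rfl⟩ := hy
      rw [lie_loopMon]
      exact Submodule.subset_span ⟨_, _, by lia, rfl⟩

theorem form_eq_zero_of_polyPart {F : LinearMap.BilinForm ℂ (LoopAlg 𝔤)}
    (h : ∀ a b i j, 0 ≤ i → 0 ≤ j → F (loopMon a i) (loopMon b j) = 0)
    {x y : LoopAlg 𝔤} (hx : x ∈ polyPart 𝔤) (hy : y ∈ polyPart 𝔤) : F x y = 0 := by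
  induction hx using Submodule.span_induction with
  | zero => simp
  | add x x' _ _ h h' => simp [h, h']
  | smul r x _ h => simp [h]
  | mem x hx =>
    obtain ⟨a, i, hi, rfl⟩ := hx
    induction hy using Submodule.span_induction with
    | zero => simp
    | add y y' _ _ h h' => simp [h, h']
    | smul r y _ h => simp [h]
    | mem y hy =>
      obtain ⟨b, j, hj, rfl⟩ := hy
      exact h a b i j hi hj

theorem levelForm_polyPart (B : LinearMap.BilinForm ℂ 𝔤) {x y : LoopAlg 𝔤}
    (hx : x ∈ polyPart 𝔤) (hy : y ∈ polyPart 𝔤) : levelForm B x y = 0 :=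
  form_eq_zero_of_polyPart (fun a b i j hi hj => by
    rw [levelForm_loopMon]
    split_ifs
    · rw [show i = 0 by lia]; simp
    · rfl) hx hy

theorem shiftForm_polyPart (ψ : LinearMap.BilinForm ℂ 𝔤) {x y : LoopAlg 𝔤}
    (hx : x ∈ polyPart 𝔤) (hy : y ∈ polyPart 𝔤) : shiftForm ψ x y = 0 :=
  form_eq_zero_of_polyPart (fun a b i j hi hj => by
    rw [shiftForm_loopMon, if_neg (by lia)]) hx hy

/-- The subalgebra `𝔤 ⊗ ℂ[t] ⊕ (centre M)` of the extension. -/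
def nonnegPart : LieSubalgebra ℂ (LieAlgebra.ofTwoCocycle c) where
  carrier := {x | ((ofProd c).symm x).1 ∈ polyPart 𝔤}
  zero_mem' := by simp
  add_mem' {x y} hx hy := by
    simp only [Set.mem_ofPred_eq, of_symm_add, Prod.fst_add] at *
    exact add_mem hx hy
  smul_mem' r x hx := by
    simp only [Set.mem_ofPred_eq, of_symm_smul, Prod.smul_fst] at *
    exact Submodule.smul_mem _ r hx
  lie_mem' {x y} hx hy := by
    simp only [bracket_ofTwoCocycle]
    exact lie_mem_polyPart hx hy

attribute [local instance 100] LieRing.ofAssociativeRing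

/-- The character of `𝔤 ⊗ ℂ[t] ⊕ (centre M)` that kills `𝔤 ⊗ ℂ[t]` and equals `l` on the centre. -/
def levelChar (l : M →ₗ[ℂ] ℂ)
    (hc : ∀ x ∈ polyPart 𝔤, ∀ y ∈ polyPart 𝔤, c.1 x y = 0) : nonnegPart c →ₗ⁅ℂ⁆ ℂ where
  toFun x := l (TrivialLieModule.equiv ℂ (LoopAlg 𝔤) M ((ofProd c).symm x.1).2)
  map_add' x y := by simp
  map_smul' r x := by simp
  map_lie' {x y} := by
    have h : ((ofProd c).symm ⁅x.1, y.1⁆).2 = 0 := by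
      simp only [bracket_ofTwoCocycle, Equiv.symm_apply_apply, trivial_lie_zero, add_zero, sub_zero]
      exact hc _ x.2 _ y.2
    simp [h, LieRing.of_associative_ring_bracket, mul_comm]

end Extension

variable (B ψ : LinearMap.BilinForm ℂ 𝔤) (hB : B.IsSymm) (hinv : B.lieInvariant 𝔤)
  (hψ : IsTwoCocycle ψ)

/-- The affine Lie algebra `𝔤̂ = 𝔤 ⊗ ℂ[t,t⁻¹] ⊕ ℂ K₂`. -/
abbrev AffineHat := LieAlgebra.ofTwoCocycle (hatCocycle B hB hinv)

/-- The generalized affine Lie algebra `𝔤̃ = 𝔤 ⊗ ℂ[t,t⁻¹] ⊕ ℂ K₁ ⊕ ℂ K₂`. -/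
abbrev AffineTilde := LieAlgebra.ofTwoCocycle (tildeCocycle B ψ hB hinv hψ)

/-- `a ⊗ tⁿ` in `𝔤̂`. -/
def hatEl (a : 𝔤) (n : ℤ) : AffineHat B hB hinv := genEl _ a n

/-- `K₂` in `𝔤̂`. -/
def hatK₂ : AffineHat B hB hinv := centralEl _ 1

/-- `a ⊗ tⁿ` in `𝔤̃`. -/
def tildeEl (a : 𝔤) (n : ℤ) : AffineTilde B ψ hB hinv hψ := genEl _ a n

/-- `K₁` in `𝔤̃`. -/
def tildeK₁ : AffineTilde B ψ hB hinv hψ := centralEl _ (1, 0)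

/-- `K₂` in `𝔤̃`. -/
def tildeK₂ : AffineTilde B ψ hB hinv hψ := centralEl _ (0, 1)

/-- The defining bracket of `𝔤̂`. -/
theorem lie_hatEl (a b : 𝔤) (i j : ℤ) :
    ⁅hatEl B hB hinv a i, hatEl B hB hinv b j⁆ =
      hatEl B hB hinv ⁅a, b⁆ (i + j) + (if i + j = 0 then i * B a b else 0) • hatK₂ B hB hinv := by
  rw [← levelForm_loopMon B]
  simp only [hatEl, hatK₂, genEl, centralEl, bracket_ofTwoCocycle, ← of_smul, ← of_add,
    Equiv.symm_apply_apply, trivial_lie_zero, lie_loopMon, add_zero, sub_zero]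
  refine congrArg _ (Prod.ext (by simp) ?_)
  change levelForm B _ _ = 0 + levelForm B _ _ * (1 : ℂ)
  simp

/-- The defining bracket of `𝔤̃`. -/
theorem lie_tildeEl (a b : 𝔤) (i j : ℤ) :
    ⁅tildeEl B ψ hB hinv hψ a i, tildeEl B ψ hB hinv hψ b j⁆ =
      tildeEl B ψ hB hinv hψ ⁅a, b⁆ (i + j)
        + (if i + j + 1 = 0 then ψ a b else 0) • tildeK₁ B ψ hB hinv hψ
        + (if i + j = 0 then i * B a b else 0) • tildeK₂ B ψ hB hinv hψ := by
  rw [← levelForm_loopMon B, ← shiftForm_loopMon ψ]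
  simp only [tildeEl, tildeK₁, tildeK₂, genEl, centralEl, bracket_ofTwoCocycle, ← of_smul,
    ← of_add, Equiv.symm_apply_apply, trivial_lie_zero, lie_loopMon, add_zero, sub_zero]
  refine congrArg _ (Prod.ext (by simp) ?_)
  change (shiftForm ψ (loopMon a i) (loopMon b j), (0 : ℂ)) +
      ((0 : ℂ), levelForm B (loopMon a i) (loopMon b j)) =
    (0 : ℂ × ℂ) + shiftForm ψ (loopMon a i) (loopMon b j) • ((1 : ℂ), (0 : ℂ)) +
      levelForm B (loopMon a i) (loopMon b j) • ((0 : ℂ), (1 : ℂ))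
  generalize shiftForm ψ (loopMon a i) (loopMon b j) = s
  generalize levelForm B (loopMon a i) (loopMon b j) = r
  simp

theorem lie_hatK₂ (x : AffineHat B hB hinv) : ⁅x, hatK₂ B hB hinv⁆ = 0 :=
  lie_centralEl _ x _

theorem lie_tildeK₁ (x : AffineTilde B ψ hB hinv hψ) : ⁅x, tildeK₁ B ψ hB hinv hψ⁆ = 0 :=
  lie_centralEl _ x _

theorem lie_tildeK₂ (x : AffineTilde B ψ hB hinv hψ) : ⁅x, tildeK₂ B ψ hB hinv hψ⁆ = 0 :=
  lie_centralEl _ x _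

attribute [local instance 100] LieRing.ofAssociativeRing

/-- The character of `𝔤 ⊗ ℂ[t] ⊕ ℂ K₂` with `K₂ ↦ ℓ₂`, zero on `𝔤 ⊗ ℂ[t]`. -/
def hatChar (ℓ₂ : ℂ) : nonnegPart (hatCocycle B hB hinv) →ₗ⁅ℂ⁆ ℂ :=
  levelChar _ (ℓ₂ • LinearMap.id) fun _ hx _ hy => levelForm_polyPart B hx hy

/-- The character of `𝔤 ⊗ ℂ[t] ⊕ ℂ K₁ ⊕ ℂ K₂` with `K₁ ↦ ℓ₁` and `K₂ ↦ ℓ₂`, zero on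
`𝔤 ⊗ ℂ[t]`. -/
def tildeChar (ℓ₁ ℓ₂ : ℂ) : nonnegPart (tildeCocycle B ψ hB hinv hψ) →ₗ⁅ℂ⁆ ℂ :=
  levelChar _ (ℓ₁ • LinearMap.fst ℂ ℂ ℂ + ℓ₂ • LinearMap.snd ℂ ℂ ℂ) fun x hx y hy => by
    change (shiftForm ψ x y, (0 : ℂ)) + ((0 : ℂ), levelForm B x y) = 0
    simp [levelForm_polyPart B hx hy, shiftForm_polyPart ψ hx hy]

/-- The `𝔤̂`-module `V_𝔤̂(ℓ₂,0)`. -/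
abbrev VHat (ℓ₂ : ℂ) := InducedModule (nonnegPart (hatCocycle B hB hinv)) (hatChar B hB hinv ℓ₂)

/-- The `𝔤̃`-module `V_𝔤̃(ℓ₁₂,0)`. -/
abbrev VTilde (ℓ₁ ℓ₂ : ℂ) :=
  InducedModule (nonnegPart (tildeCocycle B ψ hB hinv hψ)) (tildeChar B ψ hB hinv hψ ℓ₁ ℓ₂)

/-- `S` is the affine vertex algebra structure on `V_𝔤̂(ℓ₂,0)`: the vacuum is `1 ⊗ 1`, and
`Y(a,x) = ∑ₙ a(n) x^{-n-1}` for `a ∈ 𝔤`, identified with `a(-1)𝟏`. -/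
def IsAffineHatVA (ℓ₂ : ℂ) (S : VertexAlgebra (VHat B hB hinv ℓ₂)) : Prop :=
  S.vac = InducedModule.one _ _ ∧
    ∀ (a : 𝔤) (n : ℤ) (v : VHat B hB hinv ℓ₂),
      S.nth (InducedModule.act (hatEl B hB hinv a (-1)) S.vac) n v =
        InducedModule.act (hatEl B hB hinv a n) v

/-- `S` is the generalized affine vertex algebra structure on `V_𝔤̃(ℓ₁₂,0)`: the vacuum is
`1 ⊗ 1`, and `Y(a,x) = ∑ₙ a(n) x^{-n-1}` for `a ∈ 𝔤`, identified with `a(-1)𝟏`. -/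
def IsAffineTildeVA (ℓ₁ ℓ₂ : ℂ) (S : VertexAlgebra (VTilde B ψ hB hinv hψ ℓ₁ ℓ₂)) : Prop :=
  S.vac = InducedModule.one _ _ ∧
    ∀ (a : 𝔤) (n : ℤ) (v : VTilde B ψ hB hinv hψ ℓ₁ ℓ₂),
      S.nth (InducedModule.act (tildeEl B ψ hB hinv hψ a (-1)) S.vac) n v =
        InducedModule.act (tildeEl B ψ hB hinv hψ a n) v

end Affine

end

namespace VertexAlgebra

noncomputable section

/-! ## Residues of expansions of `(x - y)ˡ` -/

section Residues

variable {E F : Type*} [AddCommGroup E] [AddCommGroup F]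

/-! Write ψ = μ([·,·]). On the vacuum module of 𝔤̂, let a ⊗ tⁿ act by a(n) - ℓ₁ μ(a) δ_{n,-1}.
Adding scalars changes no commutator, but expressing [a,b](i+j) through the shifted operators leaves
the term ℓ₁ μ([a,b]) δ_{i+j+1,0}, which is exactly the contribution of ψ and K₁ in 𝔤̃. Only a
negative mode is shifted, so 𝟏 is still killed by the modes n ≥ 0, and the universal property yields
a map of vacuum modules; the opposite shift yields its inverse
(`exists_vacuumModule_equiv_of_coboundary`). In terms of fields, a(x) has moved by a multiple of the
identity field Y(𝟏,x), so the linear isomorphism pulls the vertex algebra of 𝔤̂ back to one with the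
prescribed fields for 𝔤̃ (`IsVacuumModuleVA.transport`). By uniqueness this is the structure in
question, and the statements on ideals, maximality and quotients are then formal.

Uniqueness holds because the Jacobi identity expresses Y(uₗv,x) through Y(u,x) and Y(v,x), and the
a(-1)𝟏 generate. Existence for 𝔤̂ is the reconstruction theorem `exists_of_generating_fields`. It
rests on Dong's lemma (`IsLocal.fieldProd`), Goddard's uniqueness theorem (`eq_zero_of_isLocal`) and
the Borcherds identity for local fields (`IsLocal.jacobi`). The last holds because both of its sides
obey one recursion in l, vanish for large l, and agree at m = 0 (`eq_finsum_choose_of_rec`).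

A formal distribution is handled as a function `D : ℤ → ℤ → E`, with `D p q` the coefficient of
x^{-p-1} y^{-q-1}; multiplication by x thus raises p by one. -/

theorem finsum_nat_succ {f : ℕ → E} (hf : (Function.support f).Finite) :
    ∑ᶠ i, f i = f 0 + ∑ᶠ i, f (i + 1) := by
  obtain ⟨N, hN⟩ := hf.bddAbove
  have h0 : ∀ i, N < i → f i = 0 := fun i hi => by
    by_contra h
    exact absurd (hN h) (by lia)
  rw [finsum_eq_sum_of_support_subset (s := Finset.range (N + 2)) f fun i hi => by
      by_contra h; exact hi (h0 i (by simp at h; lia)),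
    finsum_eq_sum_of_support_subset (s := Finset.range (N + 1)) (fun i => f (i + 1)) fun i hi => by
      by_contra h; exact hi (h0 _ (by simp at h; lia)),
    Finset.sum_range_succ' f, add_comm]

theorem finite_support_smul {f : ℕ → E} (c : ℕ → ℤ) (hf : (Function.support f).Finite) :
    (Function.support fun i => c i • f i).Finite :=
  hf.subset fun i hi h => hi (by simp [h])

theorem zsmul_finsum {f : ℕ → E} (c : ℤ) (hf : (Function.support f).Finite) :
    c • ∑ᶠ i, f i = ∑ᶠ i, c • f i :=
  AddMonoidHom.map_finsum (zsmulAddGroupHom c) hf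

/-- `D` vanishes for large second index, uniformly in the first one. -/
def Truncated (D : ℤ → ℤ → E) : Prop := ∃ N : ℤ, ∀ m n, N ≤ n → D m n = 0

/-- This finiteness gives meaning to (x - y)ˡ D when l is negative and the binomial series is
infinite. -/
theorem Truncated.finite_support {D : ℤ → ℤ → E} (hD : Truncated D) (a b : ℤ) :
    (Function.support fun i : ℕ => D (a - i) (b + i)).Finite := by
  obtain ⟨N, hN⟩ := hD
  exact finite_support_of_eventually (N - b) fun i hi => hN _ _ (by lia)

theorem Truncated.map {D : ℤ → ℤ → E} (hD : Truncated D) (f : ℤ → E →+ F) :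
    Truncated fun m n => f m (D m n) := by
  obtain ⟨N, hN⟩ := hD
  exact ⟨N, fun m n h => by simp [hN m n h]⟩

theorem Truncated.sub {D D' : ℤ → ℤ → E} (hD : Truncated D) (hD' : Truncated D') :
    Truncated fun m n => D m n - D' m n := by
  obtain ⟨N, hN⟩ := hD
  obtain ⟨N', hN'⟩ := hD'
  exact ⟨max N N', fun m n h => by simp [hN m n (by lia), hN' m n (by lia)]⟩

theorem Truncated.shift {D : ℤ → ℤ → E} (hD : Truncated D) (a b : ℤ) :
    Truncated fun m n => D (m + a) (n + b) := by
  obtain ⟨N, hN⟩ := hD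
  exact ⟨N - b, fun m n h => hN _ _ (by lia)⟩

/-- The coefficients of `(x - y)ˡ D(x,y)`, where `(x - y)ˡ` is expanded in nonnegative
powers of `y`. -/
def resL (D : ℤ → ℤ → E) (l m n : ℤ) : E :=
  ∑ᶠ i : ℕ, ((-1 : ℤ) ^ i * Ring.choose l i) • D (m + l - i) (n + i)

/-- The coefficients of `(x - y)ˡ D(x,y)`, where `(x - y)ˡ` is expanded in nonnegative
powers of `x`. -/
def resR (D : ℤ → ℤ → E) (l m n : ℤ) : E :=
  (Int.negOnePow l : ℤ) • resL (fun a b => D b a) l n m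

theorem resR_eq {D : ℤ → ℤ → E} (hD : Truncated fun a b => D b a) (l m n : ℤ) :
    resR D l m n = ∑ᶠ i : ℕ, ((-1 : ℤ) ^ i * Ring.choose l i * (Int.negOnePow l : ℤ)) •
      D (m + i) (n + l - i) := by
  rw [resR, resL, zsmul_finsum _ (finite_support_smul _ (hD.finite_support _ _))]
  exact finsum_congr fun i => by rw [smul_smul, mul_comm]

theorem resL_sub {D D' : ℤ → ℤ → E} (hD : Truncated D) (hD' : Truncated D') (l m n : ℤ) :
    resL (fun p q => D p q - D' p q) l m n = resL D l m n - resL D' l m n := by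
  simp only [resL, smul_sub]
  exact finsum_sub_distrib (finite_support_smul _ (hD.finite_support _ _))
    (finite_support_smul _ (hD'.finite_support _ _))

theorem resL_map {D : ℤ → ℤ → E} (hD : Truncated D) (f : E →+ F) (l m n : ℤ) :
    resL (fun p q => f (D p q)) l m n = f (resL D l m n) := by
  rw [resL, resL, AddMonoidHom.map_finsum _ (finite_support_smul _ (hD.finite_support _ _))]
  simp only [map_zsmul]

theorem resR_sub {D D' : ℤ → ℤ → E} (hD : Truncated fun a b => D b a)
    (hD' : Truncated fun a b => D' b a) (l m n : ℤ) :
    resR (fun p q => D p q - D' p q) l m n = resR D l m n - resR D' l m n := by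
  rw [resR, resL_sub hD hD', smul_sub]; rfl

theorem resR_map {D : ℤ → ℤ → E} (hD : Truncated fun a b => D b a) (f : E →+ F) (l m n : ℤ) :
    resR (fun p q => f (D p q)) l m n = f (resR D l m n) := by
  rw [resR, resL_map hD, resR, map_zsmul]

theorem resL_shift (D : ℤ → ℤ → E) (a b l m n : ℤ) :
    resL (fun p q => D (p + a) (q + b)) l m n = resL D l (m + a) (n + b) :=
  finsum_congr fun i => by
    beta_reduce
    rw [show m + l - i + a = m + a + l - i by ring, show n + i + b = n + b + i by ring]

theorem resR_shift (D : ℤ → ℤ → E) (a b l m n : ℤ) :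
    resR (fun p q => D (p + a) (q + b)) l m n = resR D l (m + a) (n + b) := by
  rw [resR, resL_shift (fun p q => D q p)]; rfl

theorem resL_zero (D : ℤ → ℤ → E) (m n : ℤ) : resL D 0 m n = D m n := by
  rw [resL, finsum_eq_single _ 0]
  · simp
  · intro i hi
    rw [Ring.choose_zero_pos ℤ (Nat.pos_of_ne_zero hi)]; simp

theorem resR_zero (D : ℤ → ℤ → E) (m n : ℤ) : resR D 0 m n = D m n := by
  simp [resR, resL_zero]

/-- Pascal's rule, that is, (x - y)ˡ⁺¹ = (x - y)(x - y)ˡ. -/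
theorem resL_succ {D : ℤ → ℤ → E} (hD : Truncated D) (l m n : ℤ) :
    resL D (l + 1) m n = resL D l (m + 1) n - resL D l m (n + 1) := by
  have hg : (Function.support fun i : ℕ => ((-1 : ℤ) ^ i * Ring.choose l i) •
      D (m + 1 + l - i) (n + i)).Finite := finite_support_smul _ (hD.finite_support _ _)
  rw [resL, finsum_nat_succ (finite_support_smul _ (hD.finite_support _ _)), resL,
    finsum_nat_succ hg, resL]
  simp only [add_sub_assoc _ (finsum _) (finsum _)]
  refine congrArg₂ _ ?_ ?_
  · simp [show m + (l + 1) = m + 1 + l by ring]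
  · rw [← finsum_sub_distrib
      ((hg.preimage (add_left_injective 1).injOn).subset fun i hi => by simpa using hi)
      (finite_support_smul _ (hD.finite_support _ _))]
    refine finsum_congr fun i => ?_
    rw [Ring.choose_succ_succ]
    push_cast
    rw [show m + (l + 1) - (i + 1 : ℤ) = m + l - i by ring,
      show m + 1 + l - (i + 1 : ℤ) = m + l - i by ring,
      show n + 1 + (i : ℤ) = n + (i + 1) by ring, ← sub_smul]
    congr 1
    ring

theorem resR_succ {D : ℤ → ℤ → E} (hD : Truncated fun a b => D b a) (l m n : ℤ) :
    resR D (l + 1) m n = resR D l (m + 1) n - resR D l m (n + 1) := by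
  simp only [resR]
  rw [resL_succ hD, Int.negOnePow_succ, ← smul_sub, Units.val_neg, neg_smul, ← smul_neg, neg_sub]

/-- Up to sign, the argument on the left is (∂_x + ∂_y) D. This operator annihilates (x - y)ˡ, so it
commutes with multiplication by it. This carries translation covariance over to products of fields.
-/
theorem resL_euler {D : ℤ → ℤ → E} (hD : Truncated D) (l m n : ℤ) :
    resL (fun p q => p • D (p - 1) q + q • D p (q - 1)) l m n =
      m • resL D l (m - 1) n + n • resL D l m (n - 1) := by
  have h1 := finite_support_smul (fun i => (-1 : ℤ) ^ i * Ring.choose l i)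
    (hD.finite_support (m - 1 + l) n)
  have h2 := finite_support_smul (fun i => (-1 : ℤ) ^ i * Ring.choose l i)
    (hD.finite_support (m + l) (n - 1))
  have h3 := finite_support_smul (fun i => (-1 : ℤ) ^ i * Ring.choose l i * (l - i))
    (hD.finite_support (m - 1 + l) n)
  have h4 := finite_support_smul (fun i => (-1 : ℤ) ^ i * Ring.choose l i * i)
    (hD.finite_support (m + l) (n - 1))
  -- These are the terms in which the derivatives hit (x - y)ˡ. After an index shift they cancel by
  -- (i + 1) C(l, i+1) = (l - i) C(l, i).
  have key : ∑ᶠ i : ℕ, ((-1 : ℤ) ^ i * Ring.choose l i * (l - i)) • D (m - 1 + l - i) (n + i) +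
      ∑ᶠ i : ℕ, ((-1 : ℤ) ^ i * Ring.choose l i * i) • D (m + l - i) (n - 1 + i) = 0 := by
    rw [finsum_nat_succ h4, Nat.cast_zero, mul_zero, zero_smul, zero_add,
      ← finsum_add_distrib h3
        ((h4.preimage (add_left_injective 1).injOn).subset fun i hi => by simpa using hi)]
    refine finsum_eq_zero_of_forall_eq_zero fun i => ?_
    have hc := Ring.choose_smul_choose l (Nat.le_succ i)
    rw [Nat.choose_succ_self_right, Nat.succ_sub (le_refl i), Nat.sub_self,
      Ring.choose_one_right, nsmul_eq_mul] at hc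
    push_cast at hc ⊢
    rw [show m + l - (i + 1 : ℤ) = m - 1 + l - i by ring,
      show n - 1 + (i + 1 : ℤ) = n + i by ring, ← add_smul]
    convert zero_smul ℤ _
    rw [pow_succ]
    linear_combination -(-1) ^ i * hc
  have split : resL (fun p q => p • D (p - 1) q + q • D p (q - 1)) l m n =
      (m • resL D l (m - 1) n + n • resL D l m (n - 1)) +
      (∑ᶠ i : ℕ, ((-1 : ℤ) ^ i * Ring.choose l i * (l - i)) • D (m - 1 + l - i) (n + i) +
      ∑ᶠ i : ℕ, ((-1 : ℤ) ^ i * Ring.choose l i * i) • D (m + l - i) (n - 1 + i)) := by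
    rw [resL, resL, resL, zsmul_finsum _ h1, zsmul_finsum _ h2]
    have h1' := finite_support_smul (fun _ => m) h1
    have h2' := finite_support_smul (fun _ => n) h2
    rw [← finsum_add_distrib h1' h2', ← finsum_add_distrib h3 h4, ← finsum_add_distrib
      ((h1'.union h2').subset (Function.support_add _ _))
      ((h3.union h4).subset (Function.support_add _ _))]
    refine finsum_congr fun i => ?_
    rw [show m + l - (i : ℤ) - 1 = m - 1 + l - i by ring,
      show n + (i : ℤ) - 1 = n - 1 + i by ring]
    module
  rw [split, key, add_zero]

/-- A system `G` with the recursion satisfied by the two sides of the Jacobi identity is determined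
by its values at `m = 0`. -/
theorem eq_finsum_choose_of_rec {G : ℤ → ℤ → ℤ → E}
    (hrec : ∀ l m n, G (l + 1) m n = G l (m + 1) n - G l m (n + 1)) {N : ℤ}
    (hN : ∀ l m n, N ≤ l → G l m n = 0) (l m n : ℤ) :
    G l m n = ∑ᶠ i : ℕ, Ring.choose m i • G (l + i) 0 (m + n - i) := by
  have hfin : ∀ l m n : ℤ, (Function.support fun i : ℕ => Ring.choose m i •
      G (l + i) 0 (n - i)).Finite := fun l m n =>
    finite_support_of_eventually (N - l) fun i hi => by rw [hN _ _ _ (by lia), smul_zero]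
  -- The right-hand side obeys the same recursion as `G`, by Pascal's rule in m.
  have Hrec : ∀ l m n : ℤ, ∑ᶠ i : ℕ, Ring.choose (m + 1) i • G (l + i) 0 (m + 1 + n - i) =
      (∑ᶠ i : ℕ, Ring.choose m i • G (l + i) 0 (m + (n + 1) - i)) +
        ∑ᶠ i : ℕ, Ring.choose m i • G (l + 1 + i) 0 (m + n - i) := by
    intro l m n
    rw [finsum_nat_succ (hfin l (m + 1) (m + 1 + n)), finsum_nat_succ (hfin l m (m + (n + 1))),
      add_assoc (Ring.choose m 0 • _),
      ← finsum_add_distrib (((hfin l m (m + (n + 1))).preimage (add_left_injective 1).injOn).subset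
        fun i hi => by simpa using hi) (hfin (l + 1) m (m + n))]
    refine congrArg₂ _ ?_ ?_
    · simp [show m + 1 + n = m + (n + 1) by ring]
    · refine finsum_congr fun i => ?_
      rw [Ring.choose_succ_succ, add_smul, add_comm]
      push_cast
      rw [show m + 1 + n - (i + 1 : ℤ) = m + n - i by ring,
        show m + (n + 1) - (i + 1 : ℤ) = m + n - i by ring, show l + (i + 1 : ℤ) = l + 1 + i by ring]
  rcases le_total N l with h | h
  · rw [hN _ _ _ h, finsum_eq_zero_of_forall_eq_zero]
    exact fun i => by rw [hN _ _ _ (by lia), smul_zero]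
  induction l, h using Int.leInductionDown generalizing m n with
  | base =>
    rw [hN _ _ _ le_rfl, finsum_eq_zero_of_forall_eq_zero]
    exact fun i => by rw [hN _ _ _ (by lia), smul_zero]
  | pred l hl ih =>
    have hr : ∀ m n, G l m n = G (l - 1) (m + 1) n - G (l - 1) m (n + 1) := fun m n => by
      rw [← hrec, sub_add_cancel]
    have Hr : ∀ m n : ℤ, _ := fun m n => Hrec (l - 1) m n
    simp only [sub_add_cancel] at Hr
    -- At level l - 1 the recursion ties the values at m + 1 and m together through level l, which
    -- is already known. The case m = 0 is trivial, so the induction runs upwards and downwards from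
    -- there.
    induction m using Int.induction_on generalizing n with
    | zero =>
      rw [finsum_eq_single _ 0]
      · simp
      · intro i hi
        rw [Ring.choose_zero_pos ℤ (Nat.pos_of_ne_zero hi), zero_smul]
    | succ m ihm =>
      rw [Hr, ← ihm, ← ih, hr]
      abel
    | pred m ihm =>
      have h1 := hr (-m - 1) (n - 1)
      have h2 := Hr (-m - 1) (n - 1)
      simp only [sub_add_cancel] at h1 h2
      have h3 := ihm (n - 1)
      rw [h2, ← ih, h1] at h3
      generalize G (l - 1) (-m - 1) n = x, G (l - 1) (-m) (n - 1) = y at *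
      exact add_right_cancel ((add_sub_cancel x y).trans h3)

end Residues

end

end VertexAlgebra

namespace VertexAlgebra

noncomputable section

/-! ## Multiplication by `x - y` -/

section Delta

variable {E F : Type*} [AddCommGroup E] [AddCommGroup F]

/-- Multiplication by `x - y`. -/
def delta : (ℤ → ℤ → E) →+ (ℤ → ℤ → E) where
  toFun D m n := D (m + 1) n - D m (n + 1)
  map_zero' := by ext; simp
  map_add' D D' := by ext; simp; abel

theorem delta_apply (D : ℤ → ℤ → E) (m n : ℤ) : delta D m n = D (m + 1) n - D m (n + 1) := rfl

theorem delta_iterate_map (f : E →+ F) (N : ℕ) (D : ℤ → ℤ → E) :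
    delta^[N] (fun m n => f (D m n)) = fun m n => f (delta^[N] D m n) := by
  induction N generalizing D with
  | zero => rfl
  | succ N ih =>
    simp only [Function.iterate_succ_apply]
    rw [← ih]
    congr 1
    ext m n
    simp [delta_apply]

theorem delta_iterate_shift (N : ℕ) (D : ℤ → ℤ → E) (a b : ℤ) :
    delta^[N] (fun m n => D (m + a) (n + b)) = fun m n => delta^[N] D (m + a) (n + b) := by
  induction N generalizing D with
  | zero => rfl
  | succ N ih =>
    simp only [Function.iterate_succ_apply]
    rw [← ih]
    congr 1
    ext m n
    simp only [delta_apply, add_right_comm]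

theorem delta_iterate_sub (N : ℕ) (D D' : ℤ → ℤ → E) :
    delta^[N] (fun m n => D m n - D' m n) = fun m n => delta^[N] D m n - delta^[N] D' m n :=
  iterate_map_sub delta N D D'

theorem delta_iterate_swap (N : ℕ) (D : ℤ → ℤ → E) (h : delta^[N] D = 0) :
    delta^[N] (fun m n => D n m) = 0 := by
  induction N generalizing D with
  | zero => ext m n; exact congrFun₂ h n m
  | succ N ih =>
    rw [Function.iterate_succ_apply] at h ⊢
    rw [← neg_eq_zero, ← iterate_map_neg, ← ih _ h]
    congr 1
    ext m n
    simp [delta_apply]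

theorem delta_iterate_of_le {N N' : ℕ} (hN : N ≤ N') {D : ℤ → ℤ → E} (h : delta^[N] D = 0) :
    delta^[N'] D = 0 := by
  obtain ⟨k, rfl⟩ := Nat.exists_eq_add_of_le' hN
  rw [Function.iterate_add_apply, h, iterate_map_zero]

/-- If D has no negative powers of y, the constant term in y of (x - y)ᴺ D is that of xᴺ D. This is
the substitution y = 0 in Goddard's argument. -/
theorem delta_iterate_neg_one {D : ℤ → ℤ → E} (hD : ∀ m n, 0 ≤ n → D m n = 0) (N : ℕ) (m : ℤ) :
    delta^[N] D m (-1) = D (m + N) (-1) := by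
  induction N generalizing D with
  | zero => simp
  | succ N ih =>
    rw [Function.iterate_succ_apply, ih, delta_apply, hD _ (-1 + 1) (by lia), sub_zero]
    · push_cast; rw [add_assoc]
    · intro m n hn
      rw [delta_apply, hD _ _ hn, hD _ _ (by lia), sub_zero]

theorem Truncated.delta {D : ℤ → ℤ → E} (hD : Truncated D) : Truncated (delta D) := by
  have h := (hD.shift 1 0).sub (hD.shift 0 1)
  simp only [add_zero] at h
  exact h

theorem Truncated.delta_swap {D : ℤ → ℤ → E} (hD : Truncated fun a b => D b a) :
    Truncated fun a b => VertexAlgebra.delta D b a := by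
  have h := (hD.shift 0 1).sub (hD.shift 1 0)
  simp only [add_zero] at h
  exact h

theorem resL_natCast_add {D : ℤ → ℤ → E} (hD : Truncated D) (k : ℕ) (l m n : ℤ) :
    resL D (l + k) m n = resL (delta^[k] D) l m n := by
  induction k generalizing D with
  | zero => simp
  | succ k ih =>
    rw [Function.iterate_succ_apply, ← ih hD.delta, Nat.cast_succ, ← add_assoc, resL_succ hD]
    have h := resL_sub (hD.shift 1 0) (hD.shift 0 1) (l + k) m n
    rw [resL_shift, resL_shift] at h
    simp only [add_zero] at h
    exact h.symm

theorem resR_natCast_add {D : ℤ → ℤ → E} (hD : Truncated fun a b => D b a) (k : ℕ) (l m n : ℤ) :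
    resR D (l + k) m n = resR (delta^[k] D) l m n := by
  induction k generalizing D with
  | zero => simp
  | succ k ih =>
    rw [Function.iterate_succ_apply, ← ih hD.delta_swap, Nat.cast_succ, ← add_assoc, resR_succ hD]
    have h := resR_sub (D := fun p q => D (p + 1) (q + 0)) (D' := fun p q => D (p + 0) (q + 1))
      (hD.shift 0 1) (hD.shift 1 0) (l + k) m n
    rw [resR_shift, resR_shift] at h
    simp only [add_zero] at h
    exact h.symm

/-- For l ≥ N the factor (x - y)ˡ is a polynomial, so both expansions agree and the difference is (x
- y)ˡ (D - D'), which vanishes. -/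
theorem resL_sub_resR_eq_zero {D D' : ℤ → ℤ → E} (hD : Truncated D)
    (hD' : Truncated fun a b => D' b a) {N : ℕ}
    (h : delta^[N] (fun m n => D m n - D' m n) = 0) {l : ℤ} (hl : N ≤ l) (m n : ℤ) :
    resL D l m n - resR D' l m n = 0 := by
  lift l to ℕ using by lia
  have h' := congrFun₂ (delta_iterate_of_le (by exact_mod_cast hl) h) m n
  rw [delta_iterate_sub] at h'
  rw [← zero_add (l : ℤ), resL_natCast_add hD, resR_natCast_add hD', resL_zero, resR_zero]
  exact h'

end Delta

/-! ## Dong's lemma for three-variable distributions -/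

section Dong

variable {E : Type*} [AddCommGroup E]

/-- The residue in `x` of `(x - y)ᵏ (D(x,y,z) - D'(x,y,z))`, suitably expanded. -/
def res₃ (D D' : ℤ → ℤ → ℤ → E) (k n r : ℤ) : E :=
  resL (fun p q => D p q r) k 0 n - resR (fun p q => D' p q r) k 0 n

variable {D D' : ℤ → ℤ → ℤ → E}

/-- The factor y - z does not involve x and passes through the residue in x. -/
theorem delta_res₃_yz (hD : ∀ r, Truncated fun p q => D p q r)
    (hD' : ∀ r, Truncated fun q p => D' p q r) (k : ℤ) :
    delta (res₃ D D' k) = res₃ (fun p => delta (D p)) (fun p => delta (D' p)) k := by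
  ext n r
  have e1 := resL_sub ((hD r).shift 0 1) (hD (r + 1)) k 0 n
  have e2 := resR_sub (D := fun p q => D' (p + 0) (q + 1) r) ((hD' r).shift 1 0) (hD' (r + 1)) k 0 n
  rw [resL_shift (fun p q => D p q r)] at e1
  rw [resR_shift (fun p q => D' p q r)] at e2
  simp only [add_zero] at e1 e2
  rw [res₃]
  simp only [delta_apply, e1, e2, res₃]
  abel

/-- This is y - z = (x - z) - (x - y): the first summand acts on the distributions, the second
raises the exponent k. -/
theorem delta_res₃_xz (hD : ∀ r, Truncated fun p q => D p q r)
    (hD' : ∀ r, Truncated fun q p => D' p q r) (k : ℤ) :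
    delta (res₃ D D' k) =
      res₃ (fun p q r => D (p + 1) q r - D p q (r + 1))
        (fun p q r => D' (p + 1) q r - D' p q (r + 1)) k - res₃ D D' (k + 1) := by
  ext n r
  have e1 := resL_sub ((hD r).shift 1 0) (hD (r + 1)) k 0 n
  have e2 := resR_sub (D := fun p q => D' (p + 1) (q + 0) r) ((hD' r).shift 0 1) (hD' (r + 1)) k 0 n
  rw [resL_shift (fun p q => D p q r)] at e1
  rw [resR_shift (fun p q => D' p q r)] at e2
  simp only [add_zero] at e1 e2
  simp only [Pi.sub_apply, delta_apply, res₃, e1, e2]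
  rw [resL_succ (hD r), resR_succ (hD' r)]
  abel

theorem Truncated.sub_shift₃ (hD : ∀ r, Truncated fun p q => D p q r) (a b c a' b' c' r : ℤ) :
    Truncated fun p q => D (p + a) (q + b) (r + c) - D (p + a') (q + b') (r + c') :=
  ((hD (r + c)).shift a b).sub ((hD (r + c')).shift a' b')

theorem delta_iterate_sub_shift {N : ℕ}
    (h : ∀ r, delta^[N] (fun p q => D p q r - D' p q r) = 0) (a b c a' b' c' r : ℤ) :
    delta^[N] (fun p q => (D (p + a) (q + b) (r + c) - D (p + a') (q + b') (r + c')) -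
      (D' (p + a) (q + b) (r + c) - D' (p + a') (q + b') (r + c'))) = 0 := by
  have e := delta_iterate_sub N
    (fun p q => D (p + a) (q + b) (r + c) - D' (p + a) (q + b) (r + c))
    (fun p q => D (p + a') (q + b') (r + c') - D' (p + a') (q + b') (r + c'))
  rw [delta_iterate_shift N (fun p q => D p q (r + c) - D' p q (r + c)),
    delta_iterate_shift N (fun p q => D p q (r + c') - D' p q (r + c')), h, h] at e
  simp only [Pi.zero_apply, sub_zero] at e
  rw [← Pi.zero_def, ← Pi.zero_def] at e
  rw [← e]
  congr 1
  ext p q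
  abel

/-- Each factor y - z either uses up one of the t factors x - z that kill D and D', or raises k by
one. The residue vanishes once t = 0 or k ≥ N, so N - k + t factors suffice. -/
theorem delta_iterate_res₃_of_xz {N : ℕ} (s t : ℕ) (k : ℤ) (D D' : ℤ → ℤ → ℤ → E)
    (hD : ∀ r, Truncated fun p q => D p q r) (hD' : ∀ r, Truncated fun q p => D' p q r)
    (hxy : ∀ r, delta^[N] (fun p q => D p q r - D' p q r) = 0)
    (hxz : ∀ q, delta^[t] (fun p r => D p q r) = 0)
    (hxz' : ∀ q, delta^[t] (fun p r => D' p q r) = 0) (hs : N - k + t ≤ s) :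
    delta^[s] (res₃ D D' k) = 0 := by
  by_cases hk : N ≤ k
  · rw [show res₃ D D' k = 0 from funext₂ fun n r =>
      resL_sub_resR_eq_zero (hD r) (hD' r) (hxy r) hk 0 n, iterate_map_zero]
  induction s generalizing t k D D' with
  | zero => lia
  | succ s ih =>
    rcases t with - | t
    · have h0 : D = 0 := funext₃ fun p q r => congrFun₂ (hxz q) p r
      have h0' : D' = 0 := funext₃ fun p q r => congrFun₂ (hxz' q) p r
      have : res₃ D D' k = 0 := by
        ext n r
        subst h0 h0'
        simp [res₃, resL, resR]
      rw [this, iterate_map_zero]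
    · rw [Function.iterate_succ_apply, delta_res₃_xz hD hD', iterate_map_sub]
      have h1 : delta^[s] (res₃ D D' (k + 1)) = 0 := by
        by_cases hk' : N ≤ k + 1
        · rw [show res₃ D D' (k + 1) = 0 from funext₂ fun n r =>
            resL_sub_resR_eq_zero (hD r) (hD' r) (hxy r) hk' 0 n, iterate_map_zero]
        · exact ih (t + 1) (k + 1) D D' hD hD' hxy hxz hxz' (by push_cast at hs ⊢; lia) hk'
      rw [h1, sub_zero]
      refine ih t k _ _ (fun r => ?_) (fun r => ?_) (fun r => ?_) hxz hxz'
        (by push_cast at hs ⊢; lia) hk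
      · simpa only [add_zero] using Truncated.sub_shift₃ hD 1 0 0 0 0 1 r
      · simpa only [add_zero] using
          Truncated.sub_shift₃ (D := fun p q r => D' q p r) hD' 0 1 0 0 0 1 r
      · simpa only [add_zero] using delta_iterate_sub_shift hxy 1 0 0 0 0 1 r

/-- The first u factors y - z go inside the residue and kill `D₁` and `D₁'`; the remaining s factors
dispose of `D₂` and `D₂'` by the preceding lemma. Locality in x, y is known only for the sums, which
is why the two parts are not treated separately. -/
theorem delta_iterate_res₃ {N t : ℕ} {s : ℕ} {k : ℤ} (u : ℕ) (D₁ D₂ D₁' D₂' : ℤ → ℤ → ℤ → E)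
    (hD : ∀ r, Truncated fun p q => D₁ p q r + D₂ p q r)
    (hD' : ∀ r, Truncated fun q p => D₁' p q r + D₂' p q r)
    (hxy : ∀ r, delta^[N] (fun p q => (D₁ p q r + D₂ p q r) - (D₁' p q r + D₂' p q r)) = 0)
    (hyz : ∀ p, delta^[u] (D₁ p) = 0) (hyz' : ∀ p, delta^[u] (D₁' p) = 0)
    (hxz : ∀ q, delta^[t] (fun p r => D₂ p q r) = 0)
    (hxz' : ∀ q, delta^[t] (fun p r => D₂' p q r) = 0) (hs : N - k + t ≤ s) :
    delta^[s + u] (res₃ (fun p q r => D₁ p q r + D₂ p q r)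
      (fun p q r => D₁' p q r + D₂' p q r) k) = 0 := by
  induction u generalizing D₁ D₂ D₁' D₂' with
  | zero =>
    obtain rfl : D₁ = 0 := funext fun p => hyz p
    obtain rfl : D₁' = 0 := funext fun p => hyz' p
    simp only [Pi.zero_apply, zero_add] at *
    exact delta_iterate_res₃_of_xz s t k _ _ hD hD' hxy hxz hxz' hs
  | succ u ih =>
    -- Multiplication by y - z preserves annihilation by (x - z)ᵗ.
    have hcomm : ∀ {D : ℤ → ℤ → ℤ → E}, (∀ q, delta^[t] (fun p r => D p q r) = 0) →
        ∀ q, delta^[t] (fun p r => delta (D p) q r) = 0 := fun {D} h q => by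
      have e := delta_iterate_sub t (fun p r => D p (q + 1) r) (fun p r => D (p + 0) q (r + 1))
      rw [delta_iterate_shift t (fun p r => D p q r), h, h] at e
      simp only [add_zero, Pi.zero_apply, sub_zero] at e
      exact e
    have hadd : ∀ D D' : ℤ → ℤ → ℤ → E, (fun p => delta fun q r => D p q r + D' p q r) =
        fun p q r => delta (D p) q r + delta (D' p) q r := fun D D' =>
      funext fun p => map_add delta (D p) (D' p)
    have hadd' : ∀ (D D' : ℤ → ℤ → ℤ → E) p q r, delta (D p) q r + delta (D' p) q r =
        (D p (q + 1) r + D' p (q + 1) r) - (D p q (r + 1) + D' p q (r + 1)) := fun D D' p q r => by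
      simp only [delta_apply]; abel
    rw [← add_assoc, Function.iterate_succ_apply, delta_res₃_yz hD hD', hadd, hadd]
    refine ih _ _ _ _ (fun r => ?_) (fun r => ?_) (fun r => ?_) hyz hyz' (hcomm hxz) (hcomm hxz')
    · simp only [hadd']
      simpa only [add_zero] using Truncated.sub_shift₃ hD 0 1 0 0 0 1 r
    · simp only [hadd']
      simpa only [add_zero] using Truncated.sub_shift₃
        (D := fun p q r => D₁' q p r + D₂' q p r) hD' 1 0 0 0 0 1 r
    · simp only [hadd']
      simpa only [add_zero] using delta_iterate_sub_shift hxy 0 1 0 0 0 1 r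

end Dong

end

end VertexAlgebra

namespace VertexAlgebra

noncomputable section

/-! ## Fields -/

section Fields

open VertexOperator

variable {V E : Type*} [AddCommGroup V] [Module ℂ V] [AddCommGroup E]

/-! ### Products of fields -/

theorem resL_add {D D' : ℤ → ℤ → E} (hD : Truncated D) (hD' : Truncated D') (l m n : ℤ) :
    resL (fun p q => D p q + D' p q) l m n = resL D l m n + resL D' l m n := by
  simp only [resL, smul_add]
  exact finsum_add_distrib (finite_support_smul _ (hD.finite_support _ _))
    (finite_support_smul _ (hD'.finite_support _ _))

theorem truncated_ncoeff (f : ℤ → V →+ E) (B : VertexOperator ℂ V) (w : V) :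
    Truncated fun p q => f p (ncoeff B q w) := by
  obtain ⟨N, hN⟩ := exists_ncoeff_eq_zero B w
  exact ⟨N, fun m n hn => by simp [hN n hn]⟩

/-- The coefficients of `A(x)B(y)w`. -/
def comp₂ (A B : VertexOperator ℂ V) (w : V) (p q : ℤ) : V := ncoeff A p (ncoeff B q w)

theorem truncated_comp₂ (A B : VertexOperator ℂ V) (w : V) : Truncated (comp₂ A B w) :=
  truncated_ncoeff (fun p => (ncoeff A p).toAddMonoidHom) B w

/-- The coefficients of `(x - y)ˡ A(x)B(y)w - (-y + x)ˡ B(y)A(x)w`. -/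
def jacobiLeft (A B : VertexOperator ℂ V) (w : V) (l m n : ℤ) : V :=
  resL (comp₂ A B w) l m n - resR (fun p q => comp₂ B A w q p) l m n

theorem jacobiLeft_succ (A B : VertexOperator ℂ V) (w : V) (l m n : ℤ) :
    jacobiLeft A B w (l + 1) m n = jacobiLeft A B w l (m + 1) n - jacobiLeft A B w l m (n + 1) := by
  simp only [jacobiLeft]
  rw [resL_succ (truncated_comp₂ A B w), resR_succ (truncated_comp₂ B A w)]
  abel

theorem jacobiLeft_add (A B : VertexOperator ℂ V) (w w' : V) (l m n : ℤ) :
    jacobiLeft A B (w + w') l m n = jacobiLeft A B w l m n + jacobiLeft A B w' l m n := by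
  have e := resL_add (truncated_comp₂ A B w) (truncated_comp₂ A B w') l m n
  have e' := resL_add (truncated_comp₂ B A w) (truncated_comp₂ B A w') l n m
  have h : ∀ A B : VertexOperator ℂ V,
      comp₂ A B (w + w') = fun p q => comp₂ A B w p q + comp₂ A B w' p q := fun A B => by
    ext p q; simp [comp₂]
  simp only [jacobiLeft, resR, h A B, h B A, e, e', smul_add]
  abel

theorem jacobiLeft_smul (A B : VertexOperator ℂ V) (r : ℂ) (w : V) (l m n : ℤ) :
    jacobiLeft A B (r • w) l m n = r • jacobiLeft A B w l m n := by
  have e := resL_map (truncated_comp₂ A B w) (DistribSMul.toAddMonoidHom V r) l m n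
  have e' := resL_map (truncated_comp₂ B A w) (DistribSMul.toAddMonoidHom V r) l n m
  have h : ∀ A B : VertexOperator ℂ V,
      comp₂ A B (r • w) = fun p q => r • comp₂ A B w p q :=
    fun A B => by ext p q; simp [comp₂]
  simp only [DistribSMul.toAddMonoidHom_apply] at e e'
  simp only [jacobiLeft, resR, h A B, h B A, e, e', smul_sub]
  rw [smul_comm r]

theorem jacobiLeft_bddBelow (A B : VertexOperator ℂ V) (w : V) (l m : ℤ) :
    BddBelow (Function.support fun n : ℤ => jacobiLeft A B w l m (-n - 1)) := by
  obtain ⟨N, hN⟩ := exists_ncoeff_eq_zero B w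
  obtain ⟨K, hK⟩ := exists_ncoeff_eq_zero A w
  -- In B(y)A(x)w only the finitely many modes of A with index between m and K contribute, so one
  -- bound `M` serves them all.
  obtain ⟨M, hM⟩ : ∃ M : ℤ, ∀ n, M ≤ n → ∀ i ∈ Finset.Icc m K, ncoeff B n (ncoeff A i w) = 0 := by
    rw [← Filter.eventually_atTop, Filter.eventually_all_finset]
    exact fun i _ => Filter.eventually_atTop.2 (exists_ncoeff_eq_zero B _)
  refine ⟨-max N (M + K - m - l) - 1, fun n hn => ?_⟩
  by_contra hlt
  refine hn ?_
  have h1 : resL (comp₂ A B w) l m (-n - 1) = 0 := finsum_eq_zero_of_forall_eq_zero fun i => by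
    rw [comp₂, hN _ (by lia), map_zero, smul_zero]
  have h2 : resR (fun p q => comp₂ B A w q p) l m (-n - 1) = 0 := by
    rw [resR, resL, finsum_eq_zero_of_forall_eq_zero, smul_zero]
    intro i
    rw [comp₂]
    by_cases hi : K ≤ m + i
    · rw [hK _ hi, map_zero, smul_zero]
    · rw [hM _ (by lia) _ (by simp; lia), smul_zero]
  simp only [jacobiLeft, h1, h2, sub_zero]

/-- The `l`-th product of two fields. -/
def fieldProd (A B : VertexOperator ℂ V) (l : ℤ) : VertexOperator ℂ V :=
  VertexOperator.of_coeff
    (fun n =>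
      { toFun := fun w => jacobiLeft A B w l 0 (-n - 1)
        map_add' := fun _ _ => jacobiLeft_add ..
        map_smul' := fun _ _ => jacobiLeft_smul .. })
    fun w => jacobiLeft_bddBelow A B w l 0

theorem ncoeff_fieldProd (A B : VertexOperator ℂ V) (l n : ℤ) (w : V) :
    ncoeff (fieldProd A B l) n w = jacobiLeft A B w l 0 n := by
  rw [fieldProd, ncoeff_of_coeff, LinearMap.coe_mk, AddHom.coe_mk]
  congr 1
  ring

variable (V) in
/-- The identity field. -/
def idField : VertexOperator ℂ V :=
  VertexOperator.of_coeff (fun n => if n = 0 then LinearMap.id else 0) fun w =>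
    (Set.finite_singleton (0 : ℤ)).bddBelow.mono fun n hn => by
      by_contra h
      exact hn (by simp [show n ≠ 0 from h])

theorem ncoeff_idField (n : ℤ) (w : V) :
    ncoeff (idField V) n w = if n = -1 then w else 0 := by
  rw [idField, ncoeff_of_coeff]
  by_cases h : n = -1
  · simp [h]
  · simp [h, show -n - 1 ≠ 0 by lia]

/-! ### Locality and Dong's lemma -/

/-- The coefficients of `[A(x), B(y)]w`. -/
def commutator (A B : VertexOperator ℂ V) (w : V) (p q : ℤ) : V :=
  comp₂ A B w p q - comp₂ B A w q p

/-- Mutual locality of fields. -/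
def IsLocal (A B : VertexOperator ℂ V) : Prop :=
  ∃ N : ℕ, ∀ w, delta^[N] (commutator A B w) = 0

theorem IsLocal.symm {A B : VertexOperator ℂ V} (h : IsLocal A B) : IsLocal B A := by
  obtain ⟨N, hN⟩ := h
  refine ⟨N, fun w => ?_⟩
  rw [← neg_eq_zero, ← iterate_map_neg, ← delta_iterate_swap N _ (hN w)]
  congr 1
  ext p q
  simp [commutator]

theorem isLocal_idField (A : VertexOperator ℂ V) : IsLocal (idField V) A :=
  ⟨0, fun w => by
    ext p q
    simp only [Function.iterate_zero, id_eq, commutator, comp₂, ncoeff_idField]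
    split_ifs <;> simp⟩

theorem IsLocal.add {A A' B : VertexOperator ℂ V} (h : IsLocal A B) (h' : IsLocal A' B) :
    IsLocal (A + A') B := by
  obtain ⟨N, hN⟩ := h
  obtain ⟨N', hN'⟩ := h'
  refine ⟨max N N', fun w => ?_⟩
  rw [show commutator (A + A') B w = commutator A B w + commutator A' B w by
      ext p q; simp [commutator, comp₂]; abel,
    iterate_map_add, delta_iterate_of_le (le_max_left _ _) (hN w),
    delta_iterate_of_le (le_max_right _ _) (hN' w), add_zero]

theorem IsLocal.smul {A B : VertexOperator ℂ V} (r : ℂ) (h : IsLocal A B) :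
    IsLocal (r • A) B := by
  obtain ⟨N, hN⟩ := h
  refine ⟨N, fun w => ?_⟩
  rw [show commutator (r • A) B w =
      fun p q => DistribSMul.toAddMonoidHom V r (commutator A B w p q) by
      ext p q; simp [commutator, comp₂, smul_sub], delta_iterate_map, hN]
  ext p q
  simp

theorem IsLocal.sub {A A' B : VertexOperator ℂ V} (h : IsLocal A B) (h' : IsLocal A' B) :
    IsLocal (A - A') B := by
  rw [sub_eq_add_neg, ← neg_one_smul ℂ A']
  exact h.add (h'.smul _)

/-- Dong's lemma. -/
theorem IsLocal.fieldProd {A B C : VertexOperator ℂ V} (hAB : IsLocal A B) (hAC : IsLocal A C)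
    (hBC : IsLocal B C) (k : ℤ) : IsLocal (fieldProd A B k) C := by
  obtain ⟨N, hN⟩ := hAB
  obtain ⟨t, ht⟩ := hAC
  obtain ⟨u, hu⟩ := hBC
  -- Here N, t, u are the orders of locality of the pairs (A, B), (A, C), (B, C).
  refine ⟨(N - k + t).toNat + u, fun w => ?_⟩
  -- The Leibniz rule splits [A(x)B(y), C(z)]w as `D₁ + D₂` and [B(y)A(x), C(z)]w as `D₁' + D₂'`.
  -- The parts with index 1 contain [B, C] and are killed by (y - z)ᵘ; those with index 2 contain
  -- [A, C] and are killed by (x - z)ᵗ.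
  set D₁ : ℤ → ℤ → ℤ → V := fun p q r => ncoeff A p (commutator B C w q r)
  set D₂ : ℤ → ℤ → ℤ → V := fun p q r => commutator A C (ncoeff B q w) p r
  set D₁' : ℤ → ℤ → ℤ → V := fun p q r => commutator B C (ncoeff A p w) q r
  set D₂' : ℤ → ℤ → ℤ → V := fun p q r => ncoeff B q (commutator A C w p r)
  have e : ∀ p q r, D₁ p q r + D₂ p q r =
      comp₂ A B (ncoeff C r w) p q - ncoeff C r (comp₂ A B w p q) := fun p q r => by
    simp only [D₁, D₂, commutator, comp₂, map_sub]; abel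
  have e' : ∀ p q r, D₁' p q r + D₂' p q r =
      comp₂ B A (ncoeff C r w) q p - ncoeff C r (comp₂ B A w q p) := fun p q r => by
    simp only [D₁', D₂', commutator, comp₂, map_sub]; abel
  have tr : ∀ (A B : VertexOperator ℂ V) r, Truncated fun p q => ncoeff C r (comp₂ A B w p q) :=
    fun A B r => (truncated_comp₂ A B w).map fun _ => (ncoeff C r).toAddMonoidHom
  have key := delta_iterate_res₃ (N := N) (t := t) (s := (N - k + t).toNat) (k := k) u D₁ D₂ D₁' D₂'
    (fun r => by simp only [e]; exact (truncated_comp₂ _ _ _).sub (tr _ _ _))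
    (fun r => by simp only [e']; exact (truncated_comp₂ _ _ _).sub (tr _ _ _))
    (fun r => by
      have h := delta_iterate_sub N (commutator A B (ncoeff C r w))
        (fun p q => (ncoeff C r).toAddMonoidHom (commutator A B w p q))
      rw [delta_iterate_map, hN, hN] at h
      simp only [Pi.zero_apply, map_zero, sub_zero] at h
      rw [← Pi.zero_def, ← Pi.zero_def] at h
      rw [← h]
      congr 1
      ext p q
      simp only [e, e', commutator, comp₂, LinearMap.toAddMonoidHom_coe, map_sub]
      abel)
    (fun p => by
      have h := delta_iterate_map (ncoeff A p).toAddMonoidHom u (commutator B C w)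
      rw [hu] at h
      simp only [Pi.zero_apply, map_zero] at h
      exact h)
    (fun p => hu _) (fun q => ht _)
    (fun q => by
      have h := delta_iterate_map (ncoeff B q).toAddMonoidHom t (commutator A C w)
      rw [ht] at h
      simp only [Pi.zero_apply, map_zero] at h
      exact h)
    (by lia)
  rw [← key]
  congr 1
  ext n r
  simp only [res₃, e, e']
  rw [resL_sub (truncated_comp₂ _ _ _) (tr _ _ _),
    resR_sub (D := fun p q => comp₂ B A (ncoeff C r w) q p)
      (D' := fun p q => ncoeff C r (comp₂ B A w q p)) (truncated_comp₂ _ _ _) (tr _ _ _)]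
  have f1 := resL_map (truncated_comp₂ A B w) (ncoeff C r).toAddMonoidHom k 0 n
  have f2 := resR_map (D := fun p q => comp₂ B A w q p) (truncated_comp₂ B A w)
    (ncoeff C r).toAddMonoidHom k 0 n
  simp only [LinearMap.toAddMonoidHom_coe] at f1 f2
  rw [f1, f2]
  simp only [commutator]
  conv_lhs => simp only [comp₂]
  rw [ncoeff_fieldProd, ncoeff_fieldProd]
  simp only [jacobiLeft, map_sub]
  abel

/-- The Borcherds identity for mutually local fields. -/
theorem IsLocal.jacobi {A B : VertexOperator ℂ V} (h : IsLocal A B) (w : V) (l m n : ℤ) :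
    jacobiLeft A B w l m n =
      ∑ᶠ i : ℕ, Ring.choose m i • ncoeff (VertexAlgebra.fieldProd A B (l + i)) (m + n - i) w := by
  obtain ⟨N, hN⟩ := h
  simp only [ncoeff_fieldProd]
  exact eq_finsum_choose_of_rec (N := N) (jacobiLeft_succ A B w) (fun l m n hl =>
    resL_sub_resR_eq_zero (truncated_comp₂ _ _ _) (truncated_comp₂ _ _ _) (hN w) hl m n) l m n

/-! ### Translation covariance -/

/-- Translation covariance of a field: `[T, Aₙ] = -n Aₙ₋₁`. -/
def IsCovariant (T : Module.End ℂ V) (A : VertexOperator ℂ V) : Prop :=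
  ∀ n w, T (ncoeff A n w) - ncoeff A n (T w) = -(n • ncoeff A (n - 1) w)

theorem IsCovariant.add {T : Module.End ℂ V} {A B : VertexOperator ℂ V} (hA : IsCovariant T A)
    (hB : IsCovariant T B) : IsCovariant T (A + B) := fun n w => by
  have h := hA n w
  have h' := hB n w
  simp only [map_add, Pi.add_apply, LinearMap.add_apply, smul_add, neg_add] at *
  rw [← h, ← h']
  abel

theorem IsCovariant.smul {T : Module.End ℂ V} {A : VertexOperator ℂ V} (r : ℂ)
    (hA : IsCovariant T A) : IsCovariant T (r • A) := fun n w => by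
  have h := hA n w
  simp only [map_smul, Pi.smul_apply, LinearMap.smul_apply] at *
  rw [← smul_sub, h, smul_neg, smul_comm]

theorem IsCovariant.sub {T : Module.End ℂ V} {A B : VertexOperator ℂ V} (hA : IsCovariant T A)
    (hB : IsCovariant T B) : IsCovariant T (A - B) := by
  rw [sub_eq_add_neg, ← neg_one_smul ℂ B]
  exact hA.add (hB.smul _)

theorem isCovariant_idField (T : Module.End ℂ V) : IsCovariant T (idField V) := fun n w => by
  simp only [ncoeff_idField]
  by_cases h : n = -1
  · subst h; simp
  · by_cases h0 : n = 0
    · subst h0; simp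
    · simp [h, show n - 1 ≠ -1 by lia]

theorem IsCovariant.comp₂ {T : Module.End ℂ V} {A B : VertexOperator ℂ V} (hA : IsCovariant T A)
    (hB : IsCovariant T B) (w : V) (p q : ℤ) :
    T (comp₂ A B w p q) - comp₂ A B (T w) p q =
      -(p • comp₂ A B w (p - 1) q + q • comp₂ A B w p (q - 1)) := by
  have h := hA p (ncoeff B q w)
  have h' := congrArg (ncoeff A p) (hB q w)
  simp only [map_neg, map_sub, map_zsmul] at h'
  simp only [VertexAlgebra.comp₂, neg_add]
  rw [← h, ← h']
  abel

/-- By `resL_euler` both expansions satisfy covariance in x and y jointly. The product is the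
coefficient at m = 0, where the x-part carries the factor m and drops out. -/
theorem IsCovariant.fieldProd {T : Module.End ℂ V} {A B : VertexOperator ℂ V}
    (hA : IsCovariant T A) (hB : IsCovariant T B) (l : ℤ) :
    IsCovariant T (fieldProd A B l) := fun n w => by
  have key : ∀ {A B : VertexOperator ℂ V}, IsCovariant T A → IsCovariant T B → ∀ m n,
      T (resL (VertexAlgebra.comp₂ A B w) l m n) - resL (VertexAlgebra.comp₂ A B (T w)) l m n =
      -(m • resL (VertexAlgebra.comp₂ A B w) l (m - 1) n +
        n • resL (VertexAlgebra.comp₂ A B w) l m (n - 1)) := by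
    intro A B hA hB m n
    have tr := truncated_comp₂ A B w
    have e := resL_map tr T.toAddMonoidHom l m n
    simp only [LinearMap.toAddMonoidHom_coe] at e
    have tr' : Truncated fun p q => T (VertexAlgebra.comp₂ A B w p q) :=
      tr.map fun _ => T.toAddMonoidHom
    rw [← e, ← resL_sub tr' (truncated_comp₂ A B (T w)),
      ← resL_euler tr]
    simp only [hA.comp₂ hB]
    simp only [resL, smul_neg, finsum_neg_distrib]
  simp only [ncoeff_fieldProd, jacobiLeft, resR, map_sub, map_zsmul]
  have h1 := key hA hB 0 n
  have h2 := key hB hA n 0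
  simp only [zero_smul, zero_add, add_zero] at h1 h2
  rw [sub_sub_sub_comm, h1, ← smul_sub, h2, smul_sub, smul_neg, smul_comm n]
  abel

/-! ### Creative fields and Goddard's uniqueness theorem -/

/-- A field `A` is creative if `Aₙ vac = 0` for `n ≥ 0`. -/
def IsCreative (vac : V) (A : VertexOperator ℂ V) : Prop := ∀ n, 0 ≤ n → ncoeff A n vac = 0

theorem isCreative_idField (vac : V) : IsCreative vac (idField V) := fun n hn => by
  rw [ncoeff_idField, if_neg (by lia)]

/-- At m = 0 the expansion involves only the modes Aᵢ with i ≥ 0, which kill the vacuum. -/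
theorem resR_comp₂_of_isCreative {vac : V} {A : VertexOperator ℂ V} (hA : IsCreative vac A)
    (B : VertexOperator ℂ V) (l n : ℤ) : resR (fun p q => comp₂ B A vac q p) l 0 n = 0 := by
  rw [resR, resL, finsum_eq_zero_of_forall_eq_zero, smul_zero]
  intro i
  rw [comp₂, hA _ (by lia), map_zero, smul_zero]

theorem IsCreative.fieldProd {vac : V} {A B : VertexOperator ℂ V} (hA : IsCreative vac A)
    (hB : IsCreative vac B) (l : ℤ) : IsCreative vac (fieldProd A B l) := fun n hn => by
  rw [ncoeff_fieldProd, jacobiLeft, resR_comp₂_of_isCreative hA, sub_zero, resL,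
    finsum_eq_zero_of_forall_eq_zero]
  intro i
  rw [comp₂, hB _ (by lia), map_zero, smul_zero]

/-- Only the i = 0 term survives, because Bᵢ₋₁ kills the vacuum for i > 0. So the product of fields
creates the product of the created vectors. -/
theorem fieldProd_vac {vac : V} {A B : VertexOperator ℂ V} (hA : IsCreative vac A)
    (hB : IsCreative vac B) (l : ℤ) :
    ncoeff (fieldProd A B l) (-1) vac = ncoeff A l (ncoeff B (-1) vac) := by
  rw [ncoeff_fieldProd, jacobiLeft, resR_comp₂_of_isCreative hA, sub_zero, resL,
    finsum_eq_single _ 0]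
  · simp [comp₂]
  · intro i hi
    rw [comp₂, hB _ (by lia), map_zero, smul_zero]

theorem IsCreative.add {vac : V} {A B : VertexOperator ℂ V} (hA : IsCreative vac A)
    (hB : IsCreative vac B) : IsCreative vac (A + B) := fun n hn => by
  simp [hA n hn, hB n hn]

theorem IsCreative.smul {vac : V} {A : VertexOperator ℂ V} (r : ℂ) (hA : IsCreative vac A) :
    IsCreative vac (r • A) := fun n hn => by
  simp [hA n hn]

theorem IsCreative.sub {vac : V} {A B : VertexOperator ℂ V} (hA : IsCreative vac A)
    (hB : IsCreative vac B) : IsCreative vac (A - B) := fun n hn => by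
  simp [hA n hn, hB n hn]

/-- Goddard's uniqueness theorem. -/
theorem eq_zero_of_isLocal {T : Module.End ℂ V} {vac : V} (hT : T vac = 0)
    {F : VertexOperator ℂ V} (hcov : IsCovariant T F) (hcre : IsCreative vac F)
    (h0 : ncoeff F (-1) vac = 0)
    (hloc : ∀ w, ∃ W, IsLocal F W ∧ IsCreative vac W ∧ ncoeff W (-1) vac = w) : F = 0 := by
  have hvac : ∀ n, ncoeff F n vac = 0 := by
    intro n
    rcases le_total (-1) n with hn | hn
    · rcases hn.eq_or_lt with rfl | hn
      · exact h0
      · exact hcre n (by lia)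
    -- Covariance gives n Fₙ₋₁ vac = 0 once Fₙ vac = 0, and n ≠ 0 here, so the vanishing spreads
    -- downwards from n = -1.
    · induction n, hn using Int.leInductionDown with
      | base => exact h0
      | pred n hn ih =>
        have h := hcov n vac
        rw [ih, hT, map_zero, map_zero, sub_zero, eq_comm, neg_eq_zero,
          ← Int.cast_smul_eq_zsmul ℂ] at h
        exact (smul_eq_zero.1 h).resolve_left (by exact_mod_cast (by lia : n ≠ 0))
  refine VIdeal.field_ext fun n w => ?_
  obtain ⟨W, ⟨N, hN⟩, hW, rfl⟩ := hloc w
  -- As F(x)vac = 0, locality reads (x - y)ᴺ F(x)W(y)vac = 0. Setting y = 0 gives xᴺ F(x)w = 0; the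
  -- index n - N undoes the factor xᴺ.
  have h := congrFun₂ (hN vac) (n - N) (-1)
  rw [delta_iterate_neg_one] at h
  · simpa [commutator, comp₂, hvac] using h
  · intro m k hk
    simp [commutator, comp₂, hvac, hW k hk]

/-! ## The reconstruction theorem -/

/-- The fields obtained from the identity field by linear combinations and left products with
fields of the family `a`. -/
inductive GeneratedField {ι : Type*} (a : ι → VertexOperator ℂ V) : VertexOperator ℂ V → Prop
  | one : GeneratedField a (idField V)
  | add {F G : VertexOperator ℂ V} :
      GeneratedField a F → GeneratedField a G → GeneratedField a (F + G)
  | smul (r : ℂ) {F : VertexOperator ℂ V} : GeneratedField a F → GeneratedField a (r • F)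
  | prod (s : ι) (k : ℤ) {F : VertexOperator ℂ V} :
      GeneratedField a F → GeneratedField a (fieldProd (a s) F k)

namespace GeneratedField

variable {ι : Type*} {a : ι → VertexOperator ℂ V} {F G : VertexOperator ℂ V}

/-- The generator `t` stays free in the induction: for the product of `a s` and `F`, Dong's lemma
needs `F` local to `a s` as well as to `a t`. -/
theorem isLocal_left (hloc : ∀ s t, IsLocal (a s) (a t)) (hF : GeneratedField a F) (t : ι) :
    IsLocal F (a t) := by
  induction hF generalizing t with
  | one => exact isLocal_idField _
  | add _ _ h h' => exact (h t).add (h' t)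
  | smul r _ h => exact (h t).smul r
  | prod s k _ h => exact (h s).symm.fieldProd (hloc s t) (h t) k

theorem isLocal_right (hloc : ∀ s t, IsLocal (a s) (a t)) {C : VertexOperator ℂ V}
    (hC : ∀ s, IsLocal (a s) C) (hF : GeneratedField a F) : IsLocal F C := by
  induction hF with
  | one => exact isLocal_idField _
  | add _ _ h h' => exact h.add h'
  | smul r _ h => exact h.smul r
  | prod s k hF h => exact (hF.isLocal_left hloc s).symm.fieldProd (hC s) h k

theorem isLocal (hloc : ∀ s t, IsLocal (a s) (a t)) (hF : GeneratedField a F)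
    (hG : GeneratedField a G) : IsLocal F G :=
  hF.isLocal_right hloc fun s => (hG.isLocal_left hloc s).symm

theorem isCovariant {T : Module.End ℂ V} (hcov : ∀ s, IsCovariant T (a s))
    (hF : GeneratedField a F) : IsCovariant T F := by
  induction hF with
  | one => exact isCovariant_idField T
  | add _ _ h h' => exact h.add h'
  | smul r _ h => exact h.smul r
  | prod s k _ h => exact (hcov s).fieldProd h k

theorem isCreative {vac : V} (hcre : ∀ s, IsCreative vac (a s)) (hF : GeneratedField a F) :
    IsCreative vac F := by
  induction hF with
  | one => exact isCreative_idField vac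
  | add _ _ h h' => exact h.add h'
  | smul r _ h => exact h.smul r
  | prod s k _ h => exact (hcre s).fieldProd h k

/-- By `fieldProd_vac` the vectors created by generated fields form a subspace stable under all
modes of the generators. -/
theorem exists_vac_eq {vac : V} (hcre : ∀ s, IsCreative vac (a s))
    (hgen : ∀ p : Submodule ℂ V, vac ∈ p → (∀ s n, ∀ v ∈ p, ncoeff (a s) n v ∈ p) → p = ⊤) (w : V) :
    ∃ W, GeneratedField a W ∧ ncoeff W (-1) vac = w := by
  let p : Submodule ℂ V :=
    { carrier := {w | ∃ W, GeneratedField a W ∧ ncoeff W (-1) vac = w}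
      zero_mem' := ⟨(0 : ℂ) • idField V, GeneratedField.one.smul 0, by simp⟩
      add_mem' := by
        rintro _ _ ⟨W, hW, rfl⟩ ⟨W', hW', rfl⟩
        exact ⟨W + W', hW.add hW', by simp⟩
      smul_mem' := by
        rintro r _ ⟨W, hW, rfl⟩
        exact ⟨r • W, hW.smul r, by simp⟩ }
  have hp : p = ⊤ := by
    refine hgen p ⟨idField V, .one, by simp [ncoeff_idField]⟩ ?_
    rintro s n _ ⟨W, hW, rfl⟩
    exact ⟨_, hW.prod s n, fieldProd_vac (hcre s) (hW.isCreative hcre) n⟩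
  exact (hp ▸ Submodule.mem_top : w ∈ p)

end GeneratedField

/-- The reconstruction theorem: a generating family of mutually local, creative, translation
covariant fields determines a vertex algebra. -/
theorem exists_of_generating_fields {ι : Type*} (a : ι → VertexOperator ℂ V) (vac : V)
    (T : Module.End ℂ V) (hT : T vac = 0) (hcov : ∀ s, IsCovariant T (a s))
    (hcre : ∀ s, IsCreative vac (a s)) (hloc : ∀ s t, IsLocal (a s) (a t))
    (hgen : ∀ p : Submodule ℂ V, vac ∈ p → (∀ s n, ∀ v ∈ p, ncoeff (a s) n v ∈ p) → p = ⊤) :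
    ∃ S : VertexAlgebra V, S.vac = vac ∧ ∀ s, S.Y (ncoeff (a s) (-1) vac) = a s := by
  -- The choice is immaterial: by Goddard's theorem a covariant creative field local to all chosen
  -- ones is determined by the vector it creates. Linearity of `Y` and `hprod` are instances of
  -- this.
  choose Y hY hYvac using GeneratedField.exists_vac_eq hcre hgen
  have uniq : ∀ {F w}, (∀ v, IsLocal F (Y v)) → IsCovariant T F → IsCreative vac F →
      ncoeff F (-1) vac = w → Y w = F := by
    intro F w h1 h2 h3 h4
    rw [eq_comm, ← sub_eq_zero]
    refine eq_zero_of_isLocal hT (h2.sub ((hY w).isCovariant hcov))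
      (h3.sub ((hY w).isCreative hcre)) (by simp [h4, hYvac]) fun v =>
      ⟨Y v, (h1 v).sub ((hY w).isLocal hloc (hY v)), (hY v).isCreative hcre, hYvac v⟩
  have uniq' : ∀ {F w}, GeneratedField a F → ncoeff F (-1) vac = w → Y w = F := fun hF h =>
    uniq (fun v => hF.isLocal hloc (hY v)) (hF.isCovariant hcov) (hF.isCreative hcre) h
  have hprod : ∀ u v l, Y (ncoeff (Y u) l v) = fieldProd (Y u) (Y v) l := fun u v l =>
    uniq (fun w => ((hY u).isLocal hloc (hY v)).fieldProd ((hY u).isLocal hloc (hY w))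
        ((hY v).isLocal hloc (hY w)) l)
      (((hY u).isCovariant hcov).fieldProd ((hY v).isCovariant hcov) l)
      (((hY u).isCreative hcre).fieldProd ((hY v).isCreative hcre) l)
      (by rw [fieldProd_vac ((hY u).isCreative hcre) ((hY v).isCreative hcre), hYvac])
  refine ⟨{ Y := ⟨⟨Y, fun u v => ?_⟩, fun r u => ?_⟩, vac := vac, vac_nth := fun n v => ?_,
            nth_vac := hYvac, nth_vac_of_nonneg := fun v n hn => (hY v).isCreative hcre n hn,
            jacobi := fun u v w l m n => ?_ }, rfl, fun s => ?_⟩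
  · exact uniq' ((hY u).add (hY v)) (by simp [hYvac])
  · exact uniq' ((hY u).smul r) (by simp [hYvac])
  · have h : Y vac = idField V := uniq' .one (by simp [ncoeff_idField])
    change ncoeff (Y vac) n v = _
    rw [h, ncoeff_idField]
  · have h := ((hY u).isLocal hloc (hY v)).jacobi w l m n
    rw [jacobiLeft, resR_eq (truncated_comp₂ _ _ _)] at h
    simp only [← hprod] at h
    exact h
  · exact uniq (fun v => ((hY v).isLocal_left hloc s).symm) (hcov s) (hcre s) rfl

end Fields

end

end VertexAlgebra

noncomputable section

attribute [local instance 100] LieRing.ofAssociativeRing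

/-! ## Induced modules: generation and universal property -/

section InducedHom

variable {L : Type*} [LieRing L] [LieAlgebra ℂ L]

/-- Since ι factors through S, the universal property gives a map from the enveloping algebra to S
whose composite with the inclusion is the identity. -/
theorem UniversalEnvelopingAlgebra.subalgebra_eq_top
    (S : Subalgebra ℂ (UniversalEnvelopingAlgebra ℂ L))
    (h : ∀ x, UniversalEnvelopingAlgebra.ι ℂ x ∈ S) : S = ⊤ := by
  let f : L →ₗ⁅ℂ⁆ S :=
    { toFun := fun x => ⟨UniversalEnvelopingAlgebra.ι ℂ x, h x⟩
      map_add' := fun x y => by ext; simp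
      map_smul' := fun r x => by ext; simp
      map_lie' := fun {x y} => by
        ext; simp [LieRing.of_associative_ring_bracket] }
  have hf : S.val.comp (UniversalEnvelopingAlgebra.lift ℂ f) =
      AlgHom.id ℂ (UniversalEnvelopingAlgebra ℂ L) := by
    refine UniversalEnvelopingAlgebra.hom_ext (R := ℂ) (LieHom.ext fun x => ?_)
    change ((UniversalEnvelopingAlgebra.lift ℂ f (UniversalEnvelopingAlgebra.ι ℂ x) : S) :
      UniversalEnvelopingAlgebra ℂ L) = UniversalEnvelopingAlgebra.ι ℂ x
    rw [UniversalEnvelopingAlgebra.lift_ι_apply]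
    rfl
  rw [eq_top_iff]
  intro u _
  have hu := DFunLike.congr_fun hf u
  change _ = u at hu
  rw [← hu]
  exact (UniversalEnvelopingAlgebra.lift ℂ f u).2

namespace InducedModule

variable {P : LieSubalgebra ℂ L} {χ : P →ₗ⁅ℂ⁆ ℂ}

theorem envelopingIncl_ι (x : P) :
    envelopingIncl P (UniversalEnvelopingAlgebra.ι ℂ x) = UniversalEnvelopingAlgebra.ι ℂ x.1 := by
  rw [envelopingIncl, UniversalEnvelopingAlgebra.lift_ι_apply]
  rfl

theorem mk_tmul (u : UniversalEnvelopingAlgebra ℂ L) (z : ℂ) :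
    (Submodule.Quotient.mk (u ⊗ₜ[ℂ] z) : InducedModule P χ) = z • u • one P χ := by
  have h : u ⊗ₜ[ℂ] z = z • u • ((1 : UniversalEnvelopingAlgebra ℂ L) ⊗ₜ[ℂ] (1 : ℂ)) := by
    rw [TensorProduct.smul_tmul', TensorProduct.smul_tmul', TensorProduct.smul_tmul]
    simp
  rw [h]
  rfl

theorem act_one (x : P) : act x.1 (one P χ) = χ x • one P χ := by
  have h : (Submodule.Quotient.mk (UniversalEnvelopingAlgebra.ι ℂ x.1 ⊗ₜ[ℂ] (1 : ℂ)) :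
      InducedModule P χ) = Submodule.Quotient.mk (1 ⊗ₜ[ℂ] (χ x)) := by
    refine (Submodule.Quotient.eq _).2 (Submodule.subset_span
      ⟨1, UniversalEnvelopingAlgebra.ι ℂ x, 1, ?_⟩)
    rw [envelopingIncl_ι, UniversalEnvelopingAlgebra.lift_ι_apply, one_mul, mul_one]
  rw [mk_tmul, mk_tmul, one_smul, one_smul] at h
  exact h

theorem induction_smul_one {p : InducedModule P χ → Prop}
    (hadd : ∀ v w, p v → p w → p (v + w)) (hmk : ∀ (z : ℂ) (u : UniversalEnvelopingAlgebra ℂ L), p (z • u • one P χ)) (v) : p v := by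
  obtain ⟨t, rfl⟩ := Submodule.Quotient.mk_surjective _ v
  induction t using TensorProduct.induction_on with
  | zero =>
    have h := hmk 0 0
    rwa [zero_smul] at h
  | add x y hx hy => exact hadd _ _ hx hy
  | tmul u z => rw [mk_tmul]; exact hmk z u

theorem act_add (x : L) (v w : InducedModule P χ) : act x (v + w) = act x v + act x w :=
  smul_add _ _ _

theorem act_smul (x : L) (r : ℂ) (v : InducedModule P χ) : act x (r • v) = r • act x v :=
  smul_comm _ _ _

theorem add_act (x y : L) (v : InducedModule P χ) : act (x + y) v = act x v + act y v := by
  simp only [act, map_add, add_smul]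

theorem smul_act (x : L) (r : ℂ) (v : InducedModule P χ) : act (r • x) v = r • act x v := by
  simp only [act, map_smul, smul_assoc]

theorem act_lie (x y : L) (v : InducedModule P χ) :
    act ⁅x, y⁆ v = act x (act y v) - act y (act x v) := by
  simp only [act, LieHom.map_lie, LieRing.of_associative_ring_bracket, sub_smul, mul_smul]

/-- Central elements of the inducing subalgebra act by scalars. -/
theorem act_of_central (x : P) (hx : ∀ y : L, ⁅y, x.1⁆ = 0) (v : InducedModule P χ) :
    act x.1 v = χ x • v := by
  -- The centralizer of ι(x) is a subalgebra containing the image of L, hence everything.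
  have hc : ∀ u, UniversalEnvelopingAlgebra.ι ℂ x.1 * u = u * UniversalEnvelopingAlgebra.ι ℂ x.1 := by
    have h := UniversalEnvelopingAlgebra.subalgebra_eq_top
      (Subalgebra.centralizer ℂ {UniversalEnvelopingAlgebra.ι ℂ x.1}) fun y => by
        rw [Subalgebra.mem_centralizer_iff]
        rintro _ rfl
        have h' := congrArg (UniversalEnvelopingAlgebra.ι ℂ) (hx y)
        rw [LieHom.map_lie, map_zero, LieRing.of_associative_ring_bracket, sub_eq_zero] at h'
        exact h'.symm
    intro u
    have hu : u ∈ Subalgebra.centralizer ℂ {UniversalEnvelopingAlgebra.ι ℂ x.1} := by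
      rw [h]; exact Algebra.mem_top
    exact (Subalgebra.mem_centralizer_iff ℂ).1 hu _ rfl
  induction v using induction_smul_one with
  | hadd v w hv hw => rw [act_add, hv, hw, smul_add]
  | hmk z u =>
    have h := act_one (χ := χ) x
    simp only [act] at h ⊢
    rw [smul_comm, ← mul_smul, hc, mul_smul, h, smul_comm u, smul_comm z]

/-- A submodule containing `1 ⊗ 1` and stable under `L` is everything. -/
theorem eq_top_of_act_mem (p : Submodule ℂ (InducedModule P χ)) (h1 : one P χ ∈ p)
    (h : ∀ (x : L), ∀ v ∈ p, act x v ∈ p) : p = ⊤ := by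
  let S : Subalgebra ℂ (UniversalEnvelopingAlgebra ℂ L) :=
    { carrier := {u | ∀ v ∈ p, u • v ∈ p}
      mul_mem' := fun ha hb v hv => by rw [mul_smul]; exact ha _ (hb _ hv)
      add_mem' := fun ha hb v hv => by rw [add_smul]; exact add_mem (ha _ hv) (hb _ hv)
      algebraMap_mem' := fun r v hv => by
        rw [algebraMap_smul]; exact p.smul_mem r hv }
  have hS : S = ⊤ := UniversalEnvelopingAlgebra.subalgebra_eq_top S h
  rw [eq_top_iff]
  intro v _
  induction v using induction_smul_one with
  | hadd v w hv hw => exact add_mem (hv trivial) (hw trivial)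
  | hmk z u => exact p.smul_mem z ((hS ▸ Algebra.mem_top : u ∈ S) _ h1)

variable {W : Type*} [AddCommGroup W] [Module ℂ W]

/-- The universal property of the induced module. -/
theorem exists_lift (σ : L →ₗ⁅ℂ⁆ Module.End ℂ W) (m : W) (hm : ∀ x : P, σ x.1 m = χ x • m) :
    ∃ f : InducedModule P χ →ₗ[ℂ] W, f (one P χ) = m ∧ ∀ x v, f (act x v) = σ x (f v) := by
  set ρ := UniversalEnvelopingAlgebra.lift ℂ σ with hρ
  -- The elements of U(P) that act on `m` through χ form a subalgebra, so it is enough to check P.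
  have hP : ∀ p, ρ (envelopingIncl P p) m = UniversalEnvelopingAlgebra.lift ℂ χ p • m := by
    let S : Subalgebra ℂ (UniversalEnvelopingAlgebra ℂ P) :=
      { carrier := {p | ρ (envelopingIncl P p) m = UniversalEnvelopingAlgebra.lift ℂ χ p • m}
        mul_mem' := fun {a b} ha hb => by
          simp only [Set.mem_ofPred_eq, map_mul, Module.End.mul_apply] at *
          rw [hb, map_smul, ha, smul_smul, mul_comm]
        add_mem' := fun {a b} ha hb => by
          simp only [Set.mem_ofPred_eq, map_add, LinearMap.add_apply] at *
          rw [ha, hb, add_smul]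
        algebraMap_mem' := fun r => by
          simp [AlgHom.commutes, Module.algebraMap_end_apply] }
    have hS : S = ⊤ := UniversalEnvelopingAlgebra.subalgebra_eq_top S fun x => by
      change ρ _ m = _
      rw [envelopingIncl_ι, hρ, UniversalEnvelopingAlgebra.lift_ι_apply,
        UniversalEnvelopingAlgebra.lift_ι_apply, hm]
    exact fun p => (hS ▸ Algebra.mem_top : p ∈ S)
  let g : UniversalEnvelopingAlgebra ℂ L ⊗[ℂ] ℂ →ₗ[ℂ] W :=
    TensorProduct.lift ((LinearMap.lsmul ℂ W).flip ∘ₗ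
      (LinearMap.applyₗ m) ∘ₗ ρ.toLinearMap)
  have hg : ∀ u z, g (u ⊗ₜ z) = z • ρ u m := fun u z => rfl
  have hgs : ∀ (u : UniversalEnvelopingAlgebra ℂ L) t, g (u • t) = ρ u (g t) := fun u t => by
    induction t using TensorProduct.induction_on with
    | zero => simp
    | add x y hx hy => rw [smul_add, map_add, hx, hy, map_add, map_add]
    | tmul a z => rw [TensorProduct.smul_tmul', hg, hg, smul_eq_mul, map_mul, map_smul]; rfl
  have hker : ∀ t ∈ inducedRel P χ, g t = 0 := fun t ht => by
    induction ht using Submodule.span_induction with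
    | zero => simp
    | add x y _ _ hx hy => rw [map_add, hx, hy, add_zero]
    | smul u x _ hx => rw [hgs, hx, map_zero]
    | mem x hx =>
      obtain ⟨u, p, z, rfl⟩ := hx
      rw [map_sub, hg, hg, map_mul, Module.End.mul_apply, hP, map_smul, smul_smul, mul_comm,
        sub_self]
  let f : InducedModule P χ →ₗ[ℂ] W :=
    (((inducedRel P χ).restrictScalars ℂ).liftQ g hker) ∘ₗ
      (Submodule.Quotient.restrictScalarsEquiv ℂ (inducedRel P χ)).symm.toLinearMap
  have hf : ∀ t, f (Submodule.Quotient.mk t) = g t := fun t => rfl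
  refine ⟨f, ?_, fun x v => ?_⟩
  · rw [one, hf, hg]; simp
  · obtain ⟨t, rfl⟩ := Submodule.Quotient.mk_surjective _ v
    change f (Submodule.Quotient.mk (UniversalEnvelopingAlgebra.ι ℂ x • t)) = _
    rw [hf, hf, hgs, hρ, UniversalEnvelopingAlgebra.lift_ι_apply]

end InducedModule

end InducedHom

/-! ## Vacuum modules of central extensions of the loop algebra -/

section VacuumModule

open LieModule.Cohomology LieAlgebra InducedModule

variable {𝔤 : Type*} [LieRing 𝔤] [LieAlgebra ℂ 𝔤] {W : Type*} [AddCommGroup W] [Module ℂ W]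

/-- The linear map on the loop algebra with prescribed values on `a ⊗ tⁿ`. -/
def loopLift (ρ : ℤ → 𝔤 →ₗ[ℂ] W) : LoopAlg 𝔤 →ₗ[ℂ] W :=
  TensorProduct.lift ((AddMonoidAlgebra.basis ℤ ℂ).constr ℂ ρ) ∘ₗ loopToTensor

theorem loopLift_loopMon (ρ : ℤ → 𝔤 →ₗ[ℂ] W) (a : 𝔤) (n : ℤ) :
    loopLift ρ (loopMon a n) = ρ n a := by
  change (AddMonoidAlgebra.basis ℤ ℂ).constr ℂ ρ (AddMonoidAlgebra.single n 1) a = _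
  rw [← AddMonoidAlgebra.basis_apply, Module.Basis.constr_basis]

variable {M : Type*} [AddCommGroup M] [Module ℂ M]
  (c : twoCocycle ℂ (LoopAlg 𝔤) (TrivialLieModule ℂ (LoopAlg 𝔤) M)) (l : M →ₗ[ℂ] ℂ)

/-- The cocycle `c` composed with the linear functional `l`. -/
def cocycleVal (x y : LoopAlg 𝔤) : ℂ := l (TrivialLieModule.equiv ℂ (LoopAlg 𝔤) M (c.1 x y))

/-- A representation of the central extension, from the action of the elements `a ⊗ tⁿ`. -/
def extensionRep (ρ : ℤ → 𝔤 →ₗ[ℂ] Module.End ℂ W)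
    (hρ : ∀ a b i j, ⁅ρ i a, ρ j b⁆ =
      ρ (i + j) ⁅a, b⁆ + cocycleVal c l (loopMon a i) (loopMon b j) • 1) :
    LieAlgebra.ofTwoCocycle c →ₗ⁅ℂ⁆ Module.End ℂ W where
  toFun x := loopLift ρ ((ofProd c).symm x).1 +
    l (TrivialLieModule.equiv ℂ (LoopAlg 𝔤) M ((ofProd c).symm x).2) • 1
  map_add' x y := by simp [add_smul]; abel
  map_smul' r x := by simp [smul_smul]
  map_lie' {x y} := by
    have key : ∀ f g : LoopAlg 𝔤, ⁅loopLift ρ f, loopLift ρ g⁆ =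
        loopLift ρ ⁅f, g⁆ + cocycleVal c l f g • 1 := fun f g => by
      induction f using loop_induction with
      | hadd f f' h h' =>
        simp only [cocycleVal, map_add, add_lie, LinearMap.add_apply, add_smul] at *
        rw [h, h']; abel
      | hmon a i =>
        induction g using loop_induction with
        | hadd g g' h h' =>
          simp only [cocycleVal, map_add, lie_add, add_smul] at *
          rw [h, h']; abel
        | hmon b j => rw [lie_loopMon]; simp only [loopLift_loopMon, hρ]
    -- The centre acts by scalars, which drop out of commutators.
    have e : ∀ (F G : Module.End ℂ W) (r s : ℂ), ⁅F + r • (1 : Module.End ℂ W),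
        G + s • (1 : Module.End ℂ W)⁆ = ⁅F, G⁆ := fun F G r s => by
      simp only [LieRing.of_associative_ring_bracket, add_mul, mul_add, smul_mul_assoc,
        mul_smul_comm, one_mul, mul_one, smul_add, smul_smul, mul_comm s r]
      abel
    rw [e, key]
    simp only [bracket_ofTwoCocycle, Equiv.symm_apply_apply, trivial_lie_zero, add_zero, sub_zero]
    rfl

theorem extensionRep_genEl (ρ : ℤ → 𝔤 →ₗ[ℂ] Module.End ℂ W) (hρ) (a : 𝔤) (n : ℤ) :
    extensionRep c l ρ hρ (genEl c a n) = ρ n a := by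
  change loopLift ρ (loopMon a n) + l (TrivialLieModule.equiv ℂ (LoopAlg 𝔤) M 0) • 1 = _
  rw [loopLift_loopMon]
  simp

variable (hc : ∀ x ∈ polyPart 𝔤, ∀ y ∈ polyPart 𝔤, c.1 x y = 0)

/-- The vacuum module of level `l`. -/
abbrev VacuumModule := InducedModule (nonnegPart c) (levelChar c l hc)

/-- The universal property of the vacuum module. -/
theorem exists_vacuumModule_hom (ρ : ℤ → 𝔤 →ₗ[ℂ] Module.End ℂ W)
    (hρ : ∀ a b i j, ⁅ρ i a, ρ j b⁆ =
      ρ (i + j) ⁅a, b⁆ + cocycleVal c l (loopMon a i) (loopMon b j) • 1)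
    (m : W) (hm : ∀ a n, 0 ≤ n → ρ n a m = 0) :
    ∃ f : VacuumModule c l hc →ₗ[ℂ] W, f (one _ _) = m ∧
      ∀ a n v, f (act (genEl c a n) v) = ρ n a (f v) := by
  obtain ⟨f, h1, h2⟩ := exists_lift (P := nonnegPart c) (χ := levelChar c l hc)
    (extensionRep c l ρ hρ) m (by
      rintro ⟨x, hx⟩
      have h : ∀ g ∈ polyPart 𝔤, loopLift ρ g m = 0 := fun g hg => by
        induction hg using Submodule.span_induction with
        | zero => simp
        | add x y _ _ hx hy => rw [map_add, LinearMap.add_apply, hx, hy, add_zero]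
        | smul r x _ hx => rw [map_smul, LinearMap.smul_apply, hx, smul_zero]
        | mem x hx =>
          obtain ⟨a, n, hn, rfl⟩ := hx
          rw [loopLift_loopMon, hm a n hn]
      change loopLift ρ ((ofProd c).symm x).1 m +
        l (TrivialLieModule.equiv ℂ (LoopAlg 𝔤) M ((ofProd c).symm x).2) • m = _
      rw [h _ hx, zero_add]
      rfl)
  exact ⟨f, h1, fun a n v => by rw [h2, extensionRep_genEl]⟩

variable {c l hc}

theorem act_centralEl (m : M) (v : VacuumModule c l hc) : act (centralEl c m) v = l m • v := by
  have h := act_of_central (P := nonnegPart c) (χ := levelChar c l hc)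
    ⟨centralEl c m, zero_mem (polyPart 𝔤)⟩ (fun y => lie_centralEl c y m) v
  rw [h]
  rfl

theorem ofProd_eq (f : LoopAlg 𝔤) (m : TrivialLieModule ℂ (LoopAlg 𝔤) M) :
    ofProd c (f, m) = ofProd c (f, 0) + centralEl c (TrivialLieModule.equiv ℂ (LoopAlg 𝔤) M m) := by
  rw [centralEl, ← of_add]
  simp

theorem lie_genEl (a b : 𝔤) (i j : ℤ) :
    ⁅genEl c a i, genEl c b j⁆ = genEl c ⁅a, b⁆ (i + j) +
      centralEl c (TrivialLieModule.equiv ℂ (LoopAlg 𝔤) M (c.1 (loopMon a i) (loopMon b j))) := by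
  simp only [genEl, bracket_ofTwoCocycle, Equiv.symm_apply_apply, trivial_lie_zero, add_zero,
    sub_zero, lie_loopMon]
  exact ofProd_eq _ _

theorem act_genEl_comm (a b : 𝔤) (i j : ℤ) (v : VacuumModule c l hc) :
    act (genEl c a i) (act (genEl c b j) v) - act (genEl c b j) (act (genEl c a i) v) =
      act (genEl c ⁅a, b⁆ (i + j)) v + cocycleVal c l (loopMon a i) (loopMon b j) • v := by
  rw [← act_lie, lie_genEl, add_act, act_centralEl]
  rfl

theorem act_genEl_one (a : 𝔤) {n : ℤ} (hn : 0 ≤ n) :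
    act (genEl c a n) (one (nonnegPart c) (levelChar c l hc)) = 0 := by
  rw [act_one (P := nonnegPart c) (χ := levelChar c l hc)
    ⟨genEl c a n, Submodule.subset_span ⟨a, n, hn, rfl⟩⟩]
  convert zero_smul ℂ _
  change l (TrivialLieModule.equiv ℂ (LoopAlg 𝔤) M 0) = 0
  simp

/-- The induction principle for vacuum modules. The centre needs no check, as it acts by scalars. -/
theorem vacuumModule_eq_top (p : Submodule ℂ (VacuumModule c l hc))
    (h1 : one _ _ ∈ p) (h : ∀ a n, ∀ v ∈ p, act (genEl c a n) v ∈ p) : p = ⊤ := by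
  refine eq_top_of_act_mem p h1 fun x v hv => ?_
  obtain ⟨⟨f, m⟩, rfl⟩ := (ofProd c).surjective x
  rw [ofProd_eq, add_act, act_centralEl]
  refine add_mem ?_ (p.smul_mem _ hv)
  induction f using loop_induction with
  | hadd f g hf hg =>
    have e : ofProd c (f + g, 0) = ofProd c (f, 0) + ofProd c (g, 0) := by
      rw [← of_add]; simp
    rw [e, add_act]
    exact add_mem hf hg
  | hmon a n => exact h a n v hv

variable (c l hc) in
/-- The operator `a(n)` on the vacuum module, linear in `a`. -/
def modeOp (n : ℤ) : 𝔤 →ₗ[ℂ] Module.End ℂ (VacuumModule c l hc) where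
  toFun a :=
    { toFun := act (genEl c a n)
      map_add' := act_add _
      map_smul' := act_smul _ }
  map_add' a b := by
    ext v
    have e : genEl c (a + b) n = genEl c a n + genEl c b n := by
      rw [genEl, genEl, genEl, ← of_add, loopMon_add]; simp
    simp only [LinearMap.coe_mk, AddHom.coe_mk, LinearMap.add_apply, e, add_act]
  map_smul' r a := by
    ext v
    have e : genEl c (r • a) n = r • genEl c a n := by
      rw [genEl, genEl, ← of_smul, loopMon_smul]; simp
    simp only [LinearMap.coe_mk, AddHom.coe_mk, LinearMap.smul_apply, e, smul_act, RingHom.id_apply]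

theorem modeOp_apply (n : ℤ) (a : 𝔤) (v : VacuumModule c l hc) :
    modeOp c l hc n a v = act (genEl c a n) v := rfl

theorem lie_modeOp (a b : 𝔤) (i j : ℤ) :
    ⁅modeOp c l hc i a, modeOp c l hc j b⁆ =
      modeOp c l hc (i + j) ⁅a, b⁆ + cocycleVal c l (loopMon a i) (loopMon b j) • 1 :=
  LinearMap.ext fun v => act_genEl_comm a b i j v

end VacuumModule

end

noncomputable section

attribute [local instance 100] LieRing.ofAssociativeRing

/-! ## The vertex algebra structure on the vacuum module of an affine Lie algebra -/

section AffineVertexAlgebra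

open LieModule.Cohomology LieAlgebra InducedModule VertexAlgebra

variable {𝔤 : Type*} [LieRing 𝔤] [LieAlgebra ℂ 𝔤] {M : Type*} [AddCommGroup M] [Module ℂ M]
  {c : twoCocycle ℂ (LoopAlg 𝔤) (TrivialLieModule ℂ (LoopAlg 𝔤) M)} {l : M →ₗ[ℂ] ℂ}
  {hc : ∀ x ∈ polyPart 𝔤, ∀ y ∈ polyPart 𝔤, c.1 x y = 0}

/-- `S` has vacuum `1 ⊗ 1` and `Y(a(-1)𝟏,x) = ∑ₙ a(n) x^{-n-1}`. -/
def IsVacuumModuleVA (S : VertexAlgebra (VacuumModule c l hc)) : Prop :=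
  S.vac = one _ _ ∧ ∀ (a : 𝔤) (n : ℤ) (v : VacuumModule c l hc),
    S.nth (act (genEl c a (-1)) S.vac) n v = act (genEl c a n) v

namespace VertexAlgebra

variable {V : Type*} [AddCommGroup V] [Module ℂ V]

/-- The Jacobi identity at m = 0, where the right-hand side reduces to its i = 0 term. -/
theorem nth_nth (S : VertexAlgebra V) (u v w : V) (l n : ℤ) :
    S.nth (S.nth u l v) n w =
      (∑ᶠ i : ℕ, ((-1 : ℤ) ^ i * Ring.choose l i) •
        VertexOperator.ncoeff (S.Y u) (0 + l - i) (VertexOperator.ncoeff (S.Y v) (n + i) w)) -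
      (∑ᶠ i : ℕ, ((-1 : ℤ) ^ i * Ring.choose l i * (Int.negOnePow l : ℤ)) •
        VertexOperator.ncoeff (S.Y v) (n + l - i) (VertexOperator.ncoeff (S.Y u) (0 + i) w)) := by
  rw [S.jacobi, finsum_eq_single _ 0]
  · simp
  · intro i hi
    rw [Ring.choose_zero_pos ℤ (Nat.pos_of_ne_zero hi), zero_smul]

end VertexAlgebra

/-- The vectors on which the two state-field maps agree contain 𝟏 and, by `nth_nth`, are stable
under all a(n). -/
theorem IsVacuumModuleVA.unique {S S' : VertexAlgebra (VacuumModule c l hc)}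
    (hS : IsVacuumModuleVA S) (hS' : IsVacuumModuleVA S') : S = S' := by
  have hvac : S.vac = S'.vac := hS.1.trans hS'.1.symm
  have ha : ∀ a, S.Y (act (genEl c a (-1)) S.vac) = S'.Y (act (genEl c a (-1)) S.vac) := fun a =>
    VIdeal.field_ext fun n v => by
      have h := hS'.2 a n v
      rw [← hvac] at h
      exact (hS.2 a n v).trans h.symm
  have hY : LinearMap.eqLocus S.Y S'.Y = ⊤ := by
    refine vacuumModule_eq_top _ ?_ fun a k u hu => ?_
    · rw [LinearMap.mem_eqLocus]
      refine VIdeal.field_ext fun n v => ?_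
      have h := S.vac_nth n v
      have h' := S'.vac_nth n v
      rw [hS.1] at h
      rw [hS'.1] at h'
      rw [h, h']
    · rw [LinearMap.mem_eqLocus] at hu ⊢
      refine VIdeal.field_ext fun n v => ?_
      have h := S.nth_nth (act (genEl c a (-1)) S.vac) u v k n
      have h' := S'.nth_nth (act (genEl c a (-1)) S.vac) u v k n
      rw [← ha, ← hu] at h'
      have e : S'.nth (act (genEl c a (-1)) S.vac) k u = S.nth (act (genEl c a (-1)) S.vac) k u := by
        rw [nth, nth, ha]
      rw [e] at h'
      rw [hS.2] at h h'
      exact h.trans h'.symm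
  refine VertexAlgebra.ext (LinearMap.ext fun u => ?_) hvac
  exact (hY ▸ Submodule.mem_top : u ∈ LinearMap.eqLocus S.Y S'.Y)

variable {β : 𝔤 → 𝔤 → ℂ}

/-- Moving a(n) past b(k) costs [a,b](n+k) and a scalar that vanishes for n > -k, so the property
passes from v to b(k)v. It has to be carried for all a at once because ⁅a, b⁆ enters. -/
theorem exists_act_eq_zero
    (hβ : ∀ a b i j, cocycleVal c l (loopMon a i) (loopMon b j) =
      if i + j = 0 then (i : ℂ) * β a b else 0) (v : VacuumModule c l hc) (a : 𝔤) :
    ∃ N : ℤ, ∀ n, N ≤ n → act (genEl c a n) v = 0 := by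
  let p : Submodule ℂ (VacuumModule c l hc) :=
    { carrier := {v | ∀ a : 𝔤, ∃ N : ℤ, ∀ n, N ≤ n → modeOp c l hc n a v = 0}
      zero_mem' := fun a => ⟨0, fun n _ => map_zero _⟩
      add_mem' := fun {v w} hv hw a => by
        obtain ⟨N, hN⟩ := hv a
        obtain ⟨K, hK⟩ := hw a
        exact ⟨max N K, fun n hn => by
          rw [map_add, hN n (by lia), hK n (by lia), add_zero]⟩
      smul_mem' := fun r v hv a => by
        obtain ⟨N, hN⟩ := hv a
        exact ⟨N, fun n hn => by rw [map_smul, hN n hn, smul_zero]⟩ }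
  have hp : p = ⊤ := by
    refine vacuumModule_eq_top p (fun a => ⟨0, fun n hn => act_genEl_one a hn⟩) ?_
    intro b k v hv a
    obtain ⟨N, hN⟩ := hv a
    obtain ⟨K, hK⟩ := hv ⁅a, b⁆
    refine ⟨max (max N (K - k)) (1 - k), fun n hn => ?_⟩
    have h := act_genEl_comm a b n k v
    rw [← modeOp_apply n a v, ← modeOp_apply (n + k), hN n (by lia), hK _ (by lia), hβ,
      if_neg (by lia), zero_smul, show act (genEl c b k) 0 = 0 from
        map_zero (modeOp c l hc k b), sub_zero, add_zero] at h
    exact h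
  exact (hp ▸ Submodule.mem_top : v ∈ p) a

/-- The field `∑ₙ a(n) x^{-n-1}`. -/
def modeField
    (hβ : ∀ a b i j, cocycleVal c l (loopMon a i) (loopMon b j) =
      if i + j = 0 then (i : ℂ) * β a b else 0) (a : 𝔤) :
    VertexOperator ℂ (VacuumModule c l hc) :=
  VertexOperator.of_coeff (fun n => modeOp c l hc (-n - 1) a) fun v => by
    obtain ⟨N, hN⟩ := exists_act_eq_zero hβ v a
    refine ⟨-N - 1, fun n hn => ?_⟩
    by_contra h
    exact hn (hN _ (by lia))

variable (hβ : ∀ a b i j, cocycleVal c l (loopMon a i) (loopMon b j) =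
      if i + j = 0 then (i : ℂ) * β a b else 0)

theorem ncoeff_modeField (a : 𝔤) (n : ℤ) (v : VacuumModule c l hc) :
    VertexOperator.ncoeff (modeField hβ a) n v = act (genEl c a n) v := by
  rw [modeField, VertexOperator.ncoeff_of_coeff, modeOp_apply]
  congr 2
  ring

/-- The order is 2: one factor x - y kills the term [a,b](p+q), which depends on p + q only, and
turns p δ_{p+q,0} into δ_{p+q+1,0}; a second factor kills that. -/
theorem isLocal_modeField (a b : 𝔤) :
    IsLocal (modeField (hc := hc) hβ a) (modeField hβ b) := by
  refine ⟨2, fun w => ?_⟩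
  have e : VertexAlgebra.commutator (modeField (hc := hc) hβ a) (modeField hβ b) w = fun p q =>
      act (genEl c ⁅a, b⁆ (p + q)) w + (if p + q = 0 then (p : ℂ) * β a b else 0) • w := by
    ext p q
    simp only [VertexAlgebra.commutator, comp₂, ncoeff_modeField, act_genEl_comm, hβ]
  have e' : delta (VertexAlgebra.commutator (modeField (hc := hc) hβ a) (modeField hβ b) w) = fun p q =>
      (if p + q + 1 = 0 then β a b else 0) • w := by
    ext p q
    rw [delta_apply, e]
    beta_reduce
    rw [show p + 1 + q = p + q + 1 by ring, show p + (q + 1) = p + q + 1 by ring,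
      add_sub_add_left_eq_sub, ← sub_smul]
    congr 1
    split_ifs
    · push_cast; ring
    · ring
  ext p q
  change delta (delta _) p q = 0
  rw [e', delta_apply, show p + 1 + q = p + (q + 1) by ring, sub_self]

/-- The derivation of the vacuum module induced by `-d/dt`. -/
theorem exists_translation : ∃ T : Module.End ℂ (VacuumModule c l hc), T (one _ _) = 0 ∧
    ∀ a, IsCovariant T (modeField hβ a) := by
  let A := modeOp c l hc
  -- Read V × V as V ⊕ εV with ε² = 0 and let a(n) act by a(n) - ε n a(n-1). A homomorphism that
  -- sends 𝟏 to 𝟏 has the form v ↦ v + ε T v, and its equivariance is the covariance of the fields.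
  let ρ : ℤ → 𝔤 →ₗ[ℂ] Module.End ℂ (VacuumModule c l hc × VacuumModule c l hc) := fun n =>
    { toFun := fun a => (A n a).prodMap (A n a) -
        n • (LinearMap.inr ℂ _ _ ∘ₗ A (n - 1) a ∘ₗ LinearMap.fst ℂ _ _)
      map_add' := fun a b => by
        ext v <;> simp <;> abel
      map_smul' := fun r a => by
        ext v <;> simp [smul_sub, smul_comm r n] }
  have hρ' : ∀ n a v w, ρ n a (v, w) = (A n a v, A n a w - n • A (n - 1) a v) := fun n a v w => by
    simp [ρ]
  obtain ⟨f, h1, h2⟩ := exists_vacuumModule_hom c l hc ρ (fun a b i j => by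
    refine LinearMap.ext fun ⟨v, w⟩ => ?_
    have hA : ∀ i j v, A i a (A j b v) - A j b (A i a v) =
        A (i + j) ⁅a, b⁆ v + (if i + j = 0 then (i : ℂ) * β a b else 0) • v := fun i j v => by
      rw [← hβ]; exact act_genEl_comm a b i j v
    simp only [LieRing.of_associative_ring_bracket, LinearMap.sub_apply, Module.End.mul_apply, hρ',
      LinearMap.add_apply, LinearMap.smul_apply, Module.End.one_apply, Prod.mk_sub_mk,
      Prod.smul_mk, Prod.mk_add_mk, map_sub, map_zsmul, hβ]
    refine Prod.ext (hA i j v) ?_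
    have e0 := hA i j w
    have e1 := hA (i - 1) j v
    have e2 := hA i (j - 1) v
    rw [show i - 1 + j = i + j - 1 by ring] at e1
    rw [show i + (j - 1) = i + j - 1 by ring] at e2
    -- The cocycle is invariant under d/dt: for j = 1 - i one has i(i - 1) + j i = 0.
    have e3 : i • ((if i + j - 1 = 0 then ((i - 1 : ℤ) : ℂ) * β a b else 0) • v) +
        j • ((if i + j - 1 = 0 then (i : ℂ) * β a b else 0) • v) = 0 := by
      split_ifs with h
      · obtain rfl : j = 1 - i := by lia
        rw [← Int.cast_smul_eq_zsmul ℂ, ← Int.cast_smul_eq_zsmul ℂ, smul_smul, smul_smul,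
          ← add_smul]
        convert zero_smul ℂ v
        push_cast
        ring
      · simp
    have e1' := congrArg (i • ·) e1
    have e2' := congrArg (j • ·) e2
    simp only [smul_sub, smul_add] at e1' e2'
    change A i a (A j b w) - j • A i a (A (j - 1) b v) - i • A (i - 1) a (A j b v) -
      (A j b (A i a w) - i • A j b (A (i - 1) a v) - j • A (j - 1) b (A i a v)) =
      A (i + j) ⁅a, b⁆ w - (i + j) • A (i + j - 1) ⁅a, b⁆ v +
        (if i + j = 0 then (i : ℂ) * β a b else 0) • w
    rw [add_smul]
    linear_combination (norm := module) e0 - e1' - e2' - e3) (one _ _, 0) (fun a n hn => by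
    rw [hρ']
    refine Prod.ext (act_genEl_one a hn) ?_
    rw [map_zero, zero_sub]
    -- The ε-part n a(n-1)𝟏 vanishes through its factor if n = 0, and because n - 1 ≥ 0 otherwise.
    rcases hn.eq_or_lt with rfl | hn
    · simp
    · rw [show A (n - 1) a (one _ _) = 0 from act_genEl_one a (by lia), smul_zero, neg_zero]
      rfl)
  have hfst : LinearMap.eqLocus (LinearMap.fst ℂ _ _ ∘ₗ f) LinearMap.id = ⊤ := by
    refine vacuumModule_eq_top _ (by simp [LinearMap.mem_eqLocus, h1]) fun a n v hv => ?_
    simp only [LinearMap.mem_eqLocus, LinearMap.comp_apply, LinearMap.fst_apply,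
      LinearMap.id_apply] at hv ⊢
    rw [h2, ← Prod.mk.eta (p := f v), hρ', hv]
    rfl
  have hfst' : ∀ v, (f v).1 = v := fun v =>
    (hfst ▸ Submodule.mem_top : v ∈ LinearMap.eqLocus (LinearMap.fst ℂ _ _ ∘ₗ f) LinearMap.id)
  refine ⟨LinearMap.snd ℂ _ _ ∘ₗ f, by simp [h1], fun a n v => ?_⟩
  simp only [ncoeff_modeField, LinearMap.comp_apply, LinearMap.snd_apply]
  rw [h2, ← Prod.mk.eta (p := f v), hρ', hfst']
  exact sub_sub_cancel_left _ _

theorem exists_isVacuumModuleVA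
    (hβ : ∀ a b i j, cocycleVal c l (loopMon a i) (loopMon b j) =
      if i + j = 0 then (i : ℂ) * β a b else 0) :
    ∃ S : VertexAlgebra (VacuumModule c l hc), IsVacuumModuleVA S := by
  obtain ⟨T, hT, hcov⟩ := exists_translation (hc := hc) hβ
  obtain ⟨S, hvac, hY⟩ := exists_of_generating_fields (modeField hβ) (one _ _) T hT hcov
    (fun a n hn => by rw [ncoeff_modeField, act_genEl_one a hn]) (isLocal_modeField hβ)
    (fun p h1 h => vacuumModule_eq_top p h1 fun a n v hv => by
      rw [← ncoeff_modeField hβ]; exact h a n v hv)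
  refine ⟨S, hvac, fun a n v => ?_⟩
  have h := hY a
  rw [ncoeff_modeField] at h
  rw [hvac, nth, h, ncoeff_modeField]

end AffineVertexAlgebra

end

noncomputable section

attribute [local instance 100] LieRing.ofAssociativeRing

/-! ## Isomorphisms of vertex algebras, ideals and quotients -/

namespace VertexAlgebra

variable {V W : Type*} [AddCommGroup V] [Module ℂ V] [AddCommGroup W] [Module ℂ W]

section Transport

variable (φ : V ≃ₗ[ℂ] W) (T : VertexAlgebra W)

/-- The field on `V` that corresponds to a field on `W` under `φ`. -/
def transportField (A : VertexOperator ℂ W) : VertexOperator ℂ V :=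
  VertexOperator.of_coeff
    (fun n => φ.symm.toLinearMap ∘ₗ VertexOperator.ncoeff A (-n - 1) ∘ₗ φ.toLinearMap) fun v => by
      obtain ⟨N, hN⟩ := exists_ncoeff_eq_zero A (φ v)
      refine ⟨-N - 1, fun n hn => ?_⟩
      by_contra h
      refine hn ?_
      change φ.symm (VertexOperator.ncoeff A (-n - 1) (φ v)) = 0
      rw [hN _ (by lia), map_zero]

theorem ncoeff_transportField (A : VertexOperator ℂ W) (n : ℤ) (v : V) :
    VertexOperator.ncoeff (transportField φ A) n v =
      φ.symm (VertexOperator.ncoeff A n (φ v)) := by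
  rw [transportField, VertexOperator.ncoeff_of_coeff]
  change φ.symm (VertexOperator.ncoeff A (-(-n - 1) - 1) (φ v)) = _
  rw [show -(-n - 1) - 1 = n by ring]

/-- Transport of a vertex algebra structure along a linear equivalence. -/
def transport : VertexAlgebra V where
  Y :=
    { toFun := fun u => transportField φ (T.Y (φ u))
      map_add' := fun u v => VIdeal.field_ext fun n w => by
        simp [ncoeff_transportField]
      map_smul' := fun r u => VIdeal.field_ext fun n w => by
        simp [ncoeff_transportField] }
  vac := φ.symm T.vac
  vac_nth n v := by
    simp only [LinearMap.coe_mk, AddHom.coe_mk, ncoeff_transportField,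
      LinearEquiv.apply_symm_apply, T.vac_nth]
    split_ifs <;> simp
  nth_vac v := by
    simp [ncoeff_transportField, T.nth_vac]
  nth_vac_of_nonneg v n hn := by
    simp [ncoeff_transportField, T.nth_vac_of_nonneg _ n hn]
  jacobi u v w l m n := by
    have h := congrArg φ.symm (T.jacobi (φ u) (φ v) (φ w) l m n)
    obtain ⟨N₁, h₁⟩ := exists_ncoeff_eq_zero (T.Y (φ v)) (φ w)
    obtain ⟨N₂, h₂⟩ := exists_ncoeff_eq_zero (T.Y (φ u)) (φ w)
    obtain ⟨N₃, h₃⟩ := exists_ncoeff_eq_zero (T.Y (φ u)) (φ v)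
    have push : ∀ {f : ℕ → W}, (Function.support f).Finite →
        φ.symm (∑ᶠ i, f i) = ∑ᶠ i, φ.symm (f i) := fun hf =>
      AddMonoidHom.map_finsum φ.symm.toAddEquiv.toAddMonoidHom hf
    rw [map_sub, push, push, push] at h
    · simpa only [LinearMap.coe_mk, AddHom.coe_mk, ncoeff_transportField,
        LinearEquiv.apply_symm_apply, map_zsmul] using h
    · exact finite_support_of_eventually (N₃ - l) fun i hi => by
        rw [h₃ _ (by lia)]; simp
    · exact finite_support_of_eventually (N₂ - m) fun i hi => by
        rw [h₂ _ (by lia)]; simp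
    · exact finite_support_of_eventually (N₁ - n) fun i hi => by
        rw [h₁ _ (by lia)]; simp

theorem nth_transport (u v : V) (n : ℤ) :
    (transport φ T).nth u n v = φ.symm (T.nth (φ u) n (φ v)) :=
  ncoeff_transportField φ (T.Y (φ u)) n v

/-- `φ` is an isomorphism from the transported structure to the given one. -/
def transportIso : (transport φ T).Iso T where
  toLinearEquiv := φ
  map_vac' := φ.apply_symm_apply _
  map_nth' u v n := by
    change φ ((transport φ T).nth u n v) = _
    rw [nth_transport, LinearEquiv.apply_symm_apply]
    rfl

end Transport

variable {S : VertexAlgebra V} {T : VertexAlgebra W}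

namespace Iso

theorem map_nth (φ : S.Iso T) (u v : V) (n : ℤ) :
    φ.toLinearEquiv (S.nth u n v) = T.nth (φ.toLinearEquiv u) n (φ.toLinearEquiv v) :=
  φ.map_nth' u v n

/-- The inverse isomorphism. -/
def symm (φ : S.Iso T) : T.Iso S where
  toLinearEquiv := φ.toLinearEquiv.symm
  map_vac' := (LinearEquiv.symm_apply_eq _).2 φ.map_vac'.symm
  map_nth' u v n := (LinearEquiv.symm_apply_eq _).2 (by
    rw [φ.map_nth]
    change _ = T.nth (φ.toLinearEquiv (φ.toLinearEquiv.symm u)) n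
      (φ.toLinearEquiv (φ.toLinearEquiv.symm v))
    rw [LinearEquiv.apply_symm_apply, LinearEquiv.apply_symm_apply])

/-- The image of an ideal under an isomorphism. -/
def mapIdeal (φ : S.Iso T) (J : S.VIdeal) : T.VIdeal where
  carrier := J.carrier.map (φ.toLinearEquiv : V →ₗ[ℂ] W)
  nth_mem v w n := by
    rintro ⟨w, hw, rfl⟩
    refine ⟨S.nth (φ.toLinearEquiv.symm v) n w, J.nth_mem _ _ _ hw, ?_⟩
    rw [LinearEquiv.coe_coe, φ.map_nth, LinearEquiv.apply_symm_apply]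
  nth_mem' v w n := by
    rintro ⟨w, hw, rfl⟩
    refine ⟨S.nth w n (φ.toLinearEquiv.symm v), J.nth_mem' _ _ _ hw, ?_⟩
    rw [LinearEquiv.coe_coe, φ.map_nth, LinearEquiv.apply_symm_apply]

/-- The order isomorphism between the ideals of isomorphic vertex algebras. -/
def idealOrderIso (φ : S.Iso T) : S.VIdeal ≃o T.VIdeal where
  toFun := φ.mapIdeal
  invFun := φ.symm.mapIdeal
  left_inv J := VIdeal.ext (by
    change (J.carrier.map (φ.toLinearEquiv : V →ₗ[ℂ] W)).map
      (φ.toLinearEquiv.symm : W →ₗ[ℂ] V) = _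
    rw [← Submodule.map_comp, LinearEquiv.symm_comp, Submodule.map_id])
  right_inv J := VIdeal.ext (by
    change (J.carrier.map (φ.toLinearEquiv.symm : W →ₗ[ℂ] V)).map
      (φ.toLinearEquiv : V →ₗ[ℂ] W) = _
    rw [← Submodule.map_comp, LinearEquiv.comp_symm, Submodule.map_id])
  map_rel_iff' {I J} := Submodule.map_le_map_iff_of_injective φ.toLinearEquiv.injective _ _

theorem carrier_idealOrderIso (φ : S.Iso T) (J : S.VIdeal) :
    (φ.idealOrderIso J).carrier = J.carrier.map (φ.toLinearEquiv : V →ₗ[ℂ] W) := rfl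

theorem carrier_idealOrderIso_eq_top (φ : S.Iso T) (J : S.VIdeal) :
    (φ.idealOrderIso J).carrier = ⊤ ↔ J.carrier = ⊤ := by
  rw [carrier_idealOrderIso]
  refine ⟨fun h => ?_, fun h => by rw [h, Submodule.map_top, LinearEquiv.range]⟩
  refine Submodule.map_injective_of_injective φ.toLinearEquiv.injective ?_
  exact h.trans (by rw [Submodule.map_top, LinearEquiv.range])

theorem isMaximal_idealOrderIso (φ : S.Iso T) (J : S.VIdeal) :
    J.IsMaximal ↔ (φ.idealOrderIso J).IsMaximal := by
  rw [VIdeal.IsMaximal, VIdeal.IsMaximal, Ne, Ne, carrier_idealOrderIso_eq_top,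
    φ.idealOrderIso.surjective.forall]
  simp only [OrderIso.lt_iff_lt, carrier_idealOrderIso_eq_top]

theorem isTheMaximal_idealOrderIso (φ : S.Iso T) (J : S.VIdeal) :
    J.IsTheMaximal ↔ (φ.idealOrderIso J).IsTheMaximal := by
  rw [VIdeal.IsTheMaximal, VIdeal.IsTheMaximal, φ.idealOrderIso.surjective.forall]
  simp only [← isMaximal_idealOrderIso, EmbeddingLike.apply_eq_iff_eq]

/-- The isomorphism of quotients induced by an isomorphism. -/
def quotIso (φ : S.Iso T) (J : S.VIdeal) : (S.quot J).Iso (T.quot (φ.idealOrderIso J)) where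
  toLinearEquiv := Submodule.Quotient.equiv J.carrier (φ.idealOrderIso J).carrier
    φ.toLinearEquiv rfl
  map_vac' := congrArg Submodule.Quotient.mk φ.map_vac'
  map_nth' x y n := by
    obtain ⟨u, rfl⟩ := Submodule.Quotient.mk_surjective _ x
    obtain ⟨v, rfl⟩ := Submodule.Quotient.mk_surjective _ y
    change Submodule.Quotient.equiv J.carrier _ φ.toLinearEquiv rfl
      (VertexOperator.ncoeff (J.quotY _) n _) =
      VertexOperator.ncoeff ((φ.idealOrderIso J).quotY
        (Submodule.Quotient.mk (φ.toLinearEquiv u))) n (Submodule.Quotient.mk (φ.toLinearEquiv v))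
    rw [VIdeal.ncoeff_quotY, VIdeal.ncoeff_quotY]
    exact congrArg Submodule.Quotient.mk (φ.map_nth u v n)

end Iso

end VertexAlgebra

/-! ## Trivial cocycles -/

section TrivialCocycle

open LieModule.Cohomology LieAlgebra InducedModule VertexAlgebra

variable {𝔤 : Type*} [LieRing 𝔤] [LieAlgebra ℂ 𝔤] {M M' : Type*} [AddCommGroup M] [Module ℂ M]
  [AddCommGroup M'] [Module ℂ M']
  {c : twoCocycle ℂ (LoopAlg 𝔤) (TrivialLieModule ℂ (LoopAlg 𝔤) M)} {l : M →ₗ[ℂ] ℂ}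
  {hc : ∀ x ∈ polyPart 𝔤, ∀ y ∈ polyPart 𝔤, c.1 x y = 0}
  {c' : twoCocycle ℂ (LoopAlg 𝔤) (TrivialLieModule ℂ (LoopAlg 𝔤) M')} {l' : M' →ₗ[ℂ] ℂ}
  {hc' : ∀ x ∈ polyPart 𝔤, ∀ y ∈ polyPart 𝔤, c'.1 x y = 0}

/-- The scalar shifts leave commutators alone, so they absorb the coboundary; they sit in mode -1,
hence the nonnegative modes still kill the vacuum. -/
theorem exists_vacuumModule_hom_of_coboundary (ν : 𝔤 →ₗ[ℂ] ℂ)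
    (h : ∀ a b i j, cocycleVal c' l' (loopMon a i) (loopMon b j) =
      cocycleVal c l (loopMon a i) (loopMon b j) + if i + j = -1 then ν ⁅a, b⁆ else 0) :
    ∃ f : VacuumModule c l hc →ₗ[ℂ] VacuumModule c' l' hc', f (one _ _) = one _ _ ∧
      ∀ a n v, f (act (genEl c a n) v) =
        act (genEl c' a n) (f v) + (if n = -1 then ν a else 0) • f v := by
  let κ : ℤ → 𝔤 →ₗ[ℂ] ℂ := fun n => if n = -1 then ν else 0
  have hκ : ∀ n a, κ n a = if n = -1 then ν a else 0 := fun n a => by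
    simp only [κ]; split_ifs <;> rfl
  obtain ⟨f, h1, h2⟩ := exists_vacuumModule_hom c l hc (fun n => modeOp c' l' hc' n +
      (κ n).smulRight (1 : Module.End ℂ (VacuumModule c' l' hc'))) (fun a b i j => by
    have e := lie_modeOp (c := c') (l := l') (hc := hc') a b i j
    simp only [LieRing.of_associative_ring_bracket, LinearMap.add_apply, LinearMap.smulRight_apply,
      add_mul, mul_add, smul_mul_assoc, mul_smul_comm, one_mul, mul_one, smul_add] at e ⊢
    rw [h, ← hκ] at e
    linear_combination (norm := module) e) (one _ _) (fun a n hn => by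
    rw [LinearMap.add_apply, LinearMap.smulRight_apply, hκ, if_neg (by lia), zero_smul, add_zero]
    exact act_genEl_one a hn)
  refine ⟨f, h1, fun a n v => ?_⟩
  rw [h2, ← hκ]
  rfl

/-- The shift by -ν gives the inverse: in both composites the shifts cancel, so the composite fixes
𝟏 and commutes with all modes. -/
theorem exists_vacuumModule_equiv_of_coboundary (ν : 𝔤 →ₗ[ℂ] ℂ)
    (h : ∀ a b i j, cocycleVal c' l' (loopMon a i) (loopMon b j) =
      cocycleVal c l (loopMon a i) (loopMon b j) + if i + j = -1 then ν ⁅a, b⁆ else 0) :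
    ∃ φ : VacuumModule c l hc ≃ₗ[ℂ] VacuumModule c' l' hc', φ (one _ _) = one _ _ ∧
      ∀ a n v, φ (act (genEl c a n) v) =
        act (genEl c' a n) (φ v) + (if n = -1 then ν a else 0) • φ v := by
  obtain ⟨f, hf1, hf⟩ := exists_vacuumModule_hom_of_coboundary (hc := hc) (hc' := hc') ν h
  obtain ⟨g, hg1, hg⟩ := exists_vacuumModule_hom_of_coboundary (c := c') (l := l') (hc := hc')
    (c' := c) (l' := l) (hc' := hc) (-ν) (fun a b i j => by
      rw [h]; split_ifs <;> simp)
  have hgf : LinearMap.eqLocus (g ∘ₗ f) LinearMap.id = ⊤ := by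
    refine vacuumModule_eq_top _ (by simp [LinearMap.mem_eqLocus, hf1, hg1]) fun a n v hv => ?_
    simp only [LinearMap.mem_eqLocus, LinearMap.comp_apply, LinearMap.id_apply] at hv ⊢
    rw [hf, map_add, map_smul, hg, hv, add_assoc, ← add_smul]
    split_ifs <;> simp
  have hfg : LinearMap.eqLocus (f ∘ₗ g) LinearMap.id = ⊤ := by
    refine vacuumModule_eq_top _ (by simp [LinearMap.mem_eqLocus, hf1, hg1]) fun a n v hv => ?_
    simp only [LinearMap.mem_eqLocus, LinearMap.comp_apply, LinearMap.id_apply] at hv ⊢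
    rw [hg, map_add, map_smul, hf, hv, add_assoc, ← add_smul]
    split_ifs <;> simp
  exact ⟨LinearEquiv.ofLinearMap f g (LinearMap.eqLocus_eq_top.1 hfg) (LinearMap.eqLocus_eq_top.1 hgf),
    hf1, hf⟩

/-- φ sends a(-1)𝟏 to a(-1)𝟏 + ν(a)𝟏, whose field in T is a(x) + ν(a) because Y(𝟏,x) is the
identity. This is precisely the field to which φ carries a(x). -/
theorem IsVacuumModuleVA.transport {ν : 𝔤 →ₗ[ℂ] ℂ}
    (φ : VacuumModule c l hc ≃ₗ[ℂ] VacuumModule c' l' hc') (h1 : φ (one _ _) = one _ _)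
    (hφ : ∀ a n v, φ (act (genEl c a n) v) =
      act (genEl c' a n) (φ v) + (if n = -1 then ν a else 0) • φ v)
    {T : VertexAlgebra (VacuumModule c' l' hc')} (hT : IsVacuumModuleVA T) :
    IsVacuumModuleVA (transport φ T) := by
  have hvac : (VertexAlgebra.transport φ T).vac = one _ _ := by
    change φ.symm T.vac = _
    rw [LinearEquiv.symm_apply_eq, h1, hT.1]
  refine ⟨hvac, fun a n v => ?_⟩
  rw [nth_transport, LinearEquiv.symm_apply_eq, hφ, hvac, hφ, h1, if_pos rfl, ← hT.1]
  have e1 := hT.2 a n (φ v)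
  have e2 := T.vac_nth n (φ v)
  simp only [nth, map_add, map_smul, Pi.add_apply, Pi.smul_apply, LinearMap.add_apply,
    LinearMap.smul_apply] at e1 ⊢
  rw [e1, e2]
  split_ifs <;> simp

theorem cocycleVal_hatCocycle (B : LinearMap.BilinForm ℂ 𝔤) (hB : B.IsSymm)
    (hinv : B.lieInvariant 𝔤) (ℓ₂ : ℂ) (a b : 𝔤) (i j : ℤ) :
    cocycleVal (hatCocycle B hB hinv) (ℓ₂ • LinearMap.id) (loopMon a i) (loopMon b j) =
      if i + j = 0 then (i : ℂ) * (ℓ₂ * B a b) else 0 := by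
  change ℓ₂ * levelForm B (loopMon a i) (loopMon b j) = _
  rw [levelForm_loopMon]
  split_ifs
  · ring
  · simp

theorem cocycleVal_tildeCocycle (B ψ : LinearMap.BilinForm ℂ 𝔤) (hB : B.IsSymm)
    (hinv : B.lieInvariant 𝔤) (hψ : IsTwoCocycle ψ) (ℓ₁ ℓ₂ : ℂ) (a b : 𝔤) (i j : ℤ) :
    cocycleVal (tildeCocycle B ψ hB hinv hψ) (ℓ₁ • LinearMap.fst ℂ ℂ ℂ + ℓ₂ • LinearMap.snd ℂ ℂ ℂ)
      (loopMon a i) (loopMon b j) =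
      ℓ₁ * (if i + j + 1 = 0 then ψ a b else 0) +
        if i + j = 0 then (i : ℂ) * (ℓ₂ * B a b) else 0 := by
  change ℓ₁ * (shiftForm ψ (loopMon a i) (loopMon b j) + 0) +
    ℓ₂ * (0 + levelForm B (loopMon a i) (loopMon b j)) = _
  rw [levelForm_loopMon, shiftForm_loopMon, add_zero, zero_add]
  congr 1
  split_ifs
  · ring
  · simp

end TrivialCocycle

end

/-! ### Comparison of the two affine vertex algebras -/

theorem mainTheorem8 {𝔤 : Type*} [LieRing 𝔤] [LieAlgebra ℂ 𝔤]
    (B : LinearMap.BilinForm ℂ 𝔤) (hB : B.IsSymm) (hinv : B.lieInvariant 𝔤)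
    (ψ : LinearMap.BilinForm ℂ 𝔤) (hψ : IsTwoCocycle ψ) (htriv : IsTrivialCocycle ψ)
    (ℓ₁ ℓ₂ : ℂ) (hℓ₁ : ℓ₁ ≠ 0) :
    (∃! S : VertexAlgebra (VTilde B ψ hB hinv hψ ℓ₁ ℓ₂), IsAffineTildeVA B ψ hB hinv hψ ℓ₁ ℓ₂ S) ∧
    (∃! T : VertexAlgebra (VHat B hB hinv ℓ₂), IsAffineHatVA B hB hinv ℓ₂ T) ∧
    ∀ (S : VertexAlgebra (VTilde B ψ hB hinv hψ ℓ₁ ℓ₂)) (T : VertexAlgebra (VHat B hB hinv ℓ₂)),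
      IsAffineTildeVA B ψ hB hinv hψ ℓ₁ ℓ₂ S → IsAffineHatVA B hB hinv ℓ₂ T →
      (∃ φ : S.Iso T, ∃ Φ : S.VIdeal ≃o T.VIdeal, ∀ J : S.VIdeal,
        (Φ J).carrier = J.carrier.map (φ.toLinearEquiv : _ →ₗ[ℂ] _) ∧
        (J.IsMaximal ↔ (Φ J).IsMaximal) ∧
        Nonempty ((S.quot J).Iso (T.quot (Φ J)))) ∧
      ((∃ J : S.VIdeal, J.IsTheMaximal) ↔ ∃ I : T.VIdeal, I.IsTheMaximal) ∧
      ∀ (J : S.VIdeal) (I : T.VIdeal), J.IsTheMaximal → I.IsTheMaximal →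
        Nonempty ((S.quot J).Iso (T.quot I)) := by
  obtain ⟨μ, hμ⟩ := htriv
  have uniqS : ∀ S S' : VertexAlgebra (VTilde B ψ hB hinv hψ ℓ₁ ℓ₂),
      IsAffineTildeVA B ψ hB hinv hψ ℓ₁ ℓ₂ S → IsAffineTildeVA B ψ hB hinv hψ ℓ₁ ℓ₂ S' → S = S' :=
    fun S S' hS hS' => IsVacuumModuleVA.unique hS hS'
  have uniqT : ∀ T T' : VertexAlgebra (VHat B hB hinv ℓ₂),
      IsAffineHatVA B hB hinv ℓ₂ T → IsAffineHatVA B hB hinv ℓ₂ T' → T = T' :=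
    fun T T' hT hT' => IsVacuumModuleVA.unique hT hT'
  obtain ⟨T₀, hT₀⟩ : ∃ T : VertexAlgebra (VHat B hB hinv ℓ₂), IsAffineHatVA B hB hinv ℓ₂ T :=
    exists_isVacuumModuleVA (cocycleVal_hatCocycle B hB hinv ℓ₂)
  obtain ⟨φ, hφ1, hφ⟩ : ∃ φ : VTilde B ψ hB hinv hψ ℓ₁ ℓ₂ ≃ₗ[ℂ] VHat B hB hinv ℓ₂,
      φ (InducedModule.one _ _) = InducedModule.one _ _ ∧
      ∀ a n v, φ (InducedModule.act (genEl _ a n) v) =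
        InducedModule.act (genEl _ a n) (φ v) + (if n = -1 then (-ℓ₁ • μ) a else 0) • φ v :=
    -- The sign: the cocycle of 𝔤̃ exceeds that of 𝔤̂ by ℓ₁ μ([a,b]) δ_{i+j+1,0}, and ν measures the
    -- difference from 𝔤̃ to 𝔤̂.
    exists_vacuumModule_equiv_of_coboundary (-ℓ₁ • μ) fun a b i j => by
      rw [cocycleVal_hatCocycle, cocycleVal_tildeCocycle, hμ]
      by_cases h : i + j = -1
      · simp [h]
      · simp [h, show i + j + 1 ≠ 0 by lia]
  have tr : ∀ T, IsAffineHatVA B hB hinv ℓ₂ T →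
      IsAffineTildeVA B ψ hB hinv hψ ℓ₁ ℓ₂ (VertexAlgebra.transport φ T) := fun T hT =>
    IsVacuumModuleVA.transport φ hφ1 hφ hT
  refine ⟨⟨_, tr T₀ hT₀, fun S hS => uniqS _ _ hS (tr T₀ hT₀)⟩,
    ⟨T₀, hT₀, fun T hT => uniqT _ _ hT hT₀⟩, fun S T hS hT => ?_⟩
  -- By uniqueness S is the transported structure, for which φ is an isomorphism by construction.
  obtain rfl := uniqS _ _ hS (tr T hT)
  let Φ := VertexAlgebra.transportIso φ T
  refine ⟨⟨Φ, Φ.idealOrderIso, fun J => ⟨Φ.carrier_idealOrderIso J, Φ.isMaximal_idealOrderIso J,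
    ⟨Φ.quotIso J⟩⟩⟩, ?_, fun J I hJ hI => ?_⟩
  · rw [Φ.idealOrderIso.surjective.exists]
    exact exists_congr Φ.isTheMaximal_idealOrderIso
  -- The image of the maximal ideal J is maximal, so it is the unique maximal ideal I.
  · obtain rfl : Φ.idealOrderIso J = I :=
      (hI _).1 ((Φ.isMaximal_idealOrderIso J).1 ((hJ J).2 rfl))
    exact ⟨Φ.quotIso J⟩
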